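/- **Definitions.** A *cyclic space* is a quadruple $(V,(\cdot,\cdot),1,\ll\cdot,\cdot\gg)$ where $(V,(\cdot,\cdot))$ is a real pre-Hilbert space, $1\in V$ is a vector with $(1,1)=1$, and $\ll\cdot,\cdot\gg$ is a hermitian positive semidefinite complex-valued form on $(V\otimes V)\otimes\mathbb C$ (linear in the first variable, conjugate linear in the second) such that for all $v,a,b,c,d\in V$ $$(v,v)=\ll v\otimes 1,v\otimes 1\gg=\ll 1\otimes v,1\otimes v\gg,$$ $$\ll a\otimes b,c\otimes d\gg=\ll c\otimes a,d\otimes b\gg,\qquad \ll a\otimes b,c\otimes d\gg=\overline{\ll b\otimes a,d\otimes c\gg}.$$ If $x_1,\dots,x_n$ is an orthonormal basis of $V$, an *$\varepsilon$-deformation* of $\ll\cdot,\cdot\gg$ is a hermitian positive semidefinite form $\ll\cdot,\cdot\gg'$ on $(V\otimes V)\otimes\mathbb C$ with $|\ll x_i\otimes x_j,x_k\otimes x_l\gg-\ll x_i\otimes x_j,x_k\otimes x_l\gg'|<\varepsilon$ for all $i,j,k,l\in\{1,\dots,n\}$. **Statement.** Let $V$ be a finite-dimensional cyclic space with orthonormal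 basis $x_1,\dots,x_n$. Then for every $\varepsilon>0$ there is a cyclic space $W_\varepsilon$ of countably infinite dimension, with form $\ll\cdot,\cdot\gg_\varepsilon$, containing $V$ as a linear subspace with the same pointed vector $1$ and with the inner product of $W_\varepsilon$ restricting to that of $V$, such that 1. the set $\{x_1,\dots,x_n\}$ extends to a (Hamel) basis $\{x_1,\dots,x_n,x_{n+1},\dots\}$ of $W_\varepsilon$; 2. the restriction of $\ll\cdot,\cdot\gg_\varepsilon$ to $(V\otimes V)\otimes\mathbb C$ is an $\varepsilon$-deformation of $\ll\cdot,\cdot\gg$; 3. for all $i,j\ge 1$, the distance of $x_i\otimes x_j$ from the complex subspace $(W_\varepsilon\otimes 1)\otimes\mathbb C$ of $(W_\varepsilon\otimes W_\varepsilon)\otimes\mathbb C$ is $0$, that is, $\inf\{d_\varepsilon(x_i\otimes x_j,z): z\in (W_\varepsilon\otimes 1)\otimes\mathbb C\}=0$, where $d_\varepsilon(u,v)=\sqrt{\ll u-v,u-v\gg_\varepsilon}$. -/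

import Mathlib

open scoped TensorProduct ComplexConjugate

noncomputable section

/-- The complex vector space `(V ⊗ V) ⊗ ℂ` attached to a real vector space `V`. -/
abbrev CxTensor (V : Type*) [AddCommGroup V] [Module ℝ V] : Type _ :=
  ℂ ⊗[ℝ] (V ⊗[ℝ] V)

/-- The elementary tensor `a ⊗ b`, seen in `(V ⊗ V) ⊗ ℂ`. -/
def pureT {V : Type*} [AddCommGroup V] [Module ℝ V] (a b : V) : CxTensor V :=
  (1 : ℂ) ⊗ₜ[ℝ] (a ⊗ₜ[ℝ] b)

/-- Complex-valued forms on `(V ⊗ V) ⊗ ℂ`, complex linear in the first variable and conjugate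
linear in the second. -/
abbrev TensorForm (V : Type*) [AddCommGroup V] [Module ℝ V] : Type _ :=
  CxTensor V →ₗ[ℂ] CxTensor V →ₗ⋆[ℂ] ℂ

/-- A scalar product on `(V ⊗ V) ⊗ ℂ`: hermitian and positive (possibly degenerate). -/
structure TensorForm.IsScalarProduct {V : Type*} [AddCommGroup V] [Module ℝ V]
    (S : TensorForm V) : Prop where
  hermitian : ∀ u v : CxTensor V, S u v = conj (S v u)
  nonneg : ∀ u : CxTensor V, 0 ≤ (S u u).re

/-- A cyclic structure on the real pre-Hilbert space `V`: a pointed unit vector together with a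
scalar product on `(V ⊗ V) ⊗ ℂ` such that `v ↦ v ⊗ 1` and `v ↦ 1 ⊗ v` are isometric, and which is
cyclic and self-adjoint. -/
structure CyclicStructure (V : Type*) [NormedAddCommGroup V] [InnerProductSpace ℝ V] where
  one : V
  inner_one_one : inner ℝ one one = 1
  form : TensorForm V
  isScalarProduct : form.IsScalarProduct
  left_isometric : ∀ v : V, form (pureT v one) (pureT v one) = ((inner ℝ v v : ℝ) : ℂ)
  right_isometric : ∀ v : V, form (pureT one v) (pureT one v) = ((inner ℝ v v : ℝ) : ℂ)
  cyclic : ∀ a b c d : V, form (pureT a b) (pureT c d) = form (pureT c a) (pureT d b)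
  selfAdjoint : ∀ a b c d : V,
    form (pureT a b) (pureT c d) = conj (form (pureT b a) (pureT d c))

/-- The restriction (pull-back) of a form along a real linear map `V → W`. -/
def TensorForm.restrict {V W : Type*} [AddCommGroup V] [Module ℝ V] [AddCommGroup W] [Module ℝ W]
    (S : TensorForm W) (f : V →ₗ[ℝ] W) : TensorForm V :=
  LinearMap.mk₂'ₛₗ (RingHom.id ℂ) (starRingEnd ℂ)
    (fun u v => S ((TensorProduct.map f f).baseChange ℂ u) ((TensorProduct.map f f).baseChange ℂ v))
    (by intros; simp) (by intros; simp) (by intros; simp) (by intros; simp)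

/-- `S'` is an `ε`-perturbation (`ε`-deformation) of `S` with respect to the family `x`. -/
def TensorForm.IsPerturbation {V : Type*} [AddCommGroup V] [Module ℝ V] {ι : Type*}
    (S : TensorForm V) (x : ι → V) (ε : ℝ) (S' : TensorForm V) : Prop :=
  S'.IsScalarProduct ∧ ∀ i j k l : ι,
    ‖S (pureT (x i) (x j)) (pureT (x k) (x l)) - S' (pureT (x i) (x j)) (pureT (x k) (x l))‖ < ε

namespace CyclicStructure

variable {V : Type*} [NormedAddCommGroup V] [InnerProductSpace ℝ V]

/-- The pseudo-distance `d(u, v) = √≪u - v, u - v≫`. -/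
def d (C : CyclicStructure V) (u v : CxTensor V) : ℝ :=
  Real.sqrt (C.form (u - v) (u - v)).re

/-- The distance of a point from a set; the infimum is over a set bounded below by `0`, and it is
only used for nonempty sets. -/
def distTo (C : CyclicStructure V) (u : CxTensor V) (s : Set (CxTensor V)) : ℝ :=
  sInf (C.d u '' s)

/-- The copy of `V ⊗ 1` in `(V ⊗ V) ⊗ ℂ`, that is, the complex subspace `(V ⊗ 1) ⊗ ℂ`. -/
def tensorOne (C : CyclicStructure V) : Submodule ℂ (CxTensor V) :=
  Submodule.span ℂ (Set.range fun v : V => pureT v C.one)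

end CyclicStructure

end

/-! Write the form as a table `T i j k l`, the value at `e i ⊗ e j` and `e l ⊗ e k`, and read it as
the trace of the word `e i e j e k e l` in self-adjoint letters. The axioms become invariance under
rotation of the word, conjugation under its reversal, and positivity; `e 0` is the pointed vector 1.

Strict positivity is what makes room for extensions. It is obtained at the cost of a small
deformation, by mixing the given form with a multiple `δ` of semicircular moments, corrected so that
`v ⊗ 1` keeps its norm exactly (`isStrict_initTable`).

To bring `e a ⊗ e b` close to `W ⊗ 1`, adjoin two real vectors `e N = y + y*` and `e (N + 1) = i (y
- y*)`, and let `y ⊗ 1` pair with everything old as `e a ⊗ e b` does, its own square norm being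
larger by `η`. Reversal forces the same for `1 ⊗ y*` and `e b ⊗ e a`, and rotation forces further
entries, which may spoil positivity. These unwanted entries involve products such as `1 ⊗ y` or `y*
⊗ 1`, and every mixed product other than `y ⊗ 1` and `1 ⊗ y*` may be given a large mass `M` without
changing the norm of `e a ⊗ e b - y ⊗ 1`. Compactness of the unit sphere (`exists_pos_add_mul`)
supplies `M`, then a mass `M'` for the products of two new vectors. The result is strictly positive
again (`IsStrict.exists_step`).

Iterating, with each pair `(a, b)` met infinitely often and `η` tending to 0, gives a strictly
positive table on all of `ℕ` (`IsStrict.exists_limit`). The tensors at distance 0 from `W ⊗ 1` form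
a subspace containing a basis, hence are all tensors, so the choice of basis in the conclusion is
immaterial. -/

noncomputable section

/-- The table of values `form (e i ⊗ e j) (e l ⊗ e k)` of a form at the quadruples `(i, j, k, l)`. -/
abbrev FormTable : Type := ℕ → ℕ → ℕ → ℕ → ℂ

/-- The index set of the tensors of two vectors among the first `N` basis vectors. -/
def sqIndex (N : ℕ) : Finset (ℕ × ℕ) := Finset.range N ×ˢ Finset.range N

lemma mem_sqIndex {N : ℕ} {p : ℕ × ℕ} : p ∈ sqIndex N ↔ p.1 < N ∧ p.2 < N := by
  simp [sqIndex]

/-! ### Sesquilinear forms given by tables -/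

namespace FormTable

/-- The sesquilinear form with table `T` on tensors supported in the square `[0, N) × [0, N)`. -/
def sesq (N : ℕ) (T : FormTable) (u v : ℕ × ℕ → ℂ) : ℂ :=
  ∑ p ∈ sqIndex N, ∑ r ∈ sqIndex N, u p * conj (v r) * T p.1 p.2 r.2 r.1

/-- A cyclic hermitian table supported on indices below `N` and strictly positive there. -/
structure IsStrict (N : ℕ) (T : FormTable) : Prop where
  cyc : ∀ i j k l, T i j k l = T j k l i
  herm : ∀ i j k l, T i j k l = conj (T l k j i)
  supp : ∀ i j k l, N ≤ i → T i j k l = 0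
  pos : ∀ u : ℕ × ℕ → ℂ, (∃ p ∈ sqIndex N, u p ≠ 0) → 0 < (sesq N T u u).re

lemma sesq_add_table (N : ℕ) (S T : FormTable) (u v : ℕ × ℕ → ℂ) :
    sesq N (fun i j k l => S i j k l + T i j k l) u v = sesq N S u v + sesq N T u v := by
  simp only [sesq, mul_add, Finset.sum_add_distrib]

lemma sesq_mul_table (N : ℕ) (c : ℂ) (T : FormTable) (u v : ℕ × ℕ → ℂ) :
    sesq N (fun i j k l => c * T i j k l) u v = c * sesq N T u v := by
  simp only [sesq, Finset.mul_sum]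
  exact Finset.sum_congr rfl fun p _ => Finset.sum_congr rfl fun r _ => by ring

lemma sesq_add_left (N : ℕ) (T : FormTable) (u v w : ℕ × ℕ → ℂ) :
    sesq N T (fun p => u p + v p) w = sesq N T u w + sesq N T v w := by
  simp only [sesq, add_mul, Finset.sum_add_distrib]

lemma sesq_add_right (N : ℕ) (T : FormTable) (u v w : ℕ × ℕ → ℂ) :
    sesq N T w (fun p => u p + v p) = sesq N T w u + sesq N T w v := by
  simp only [sesq, map_add, mul_add, add_mul, Finset.sum_add_distrib]

lemma sesq_single_left {N : ℕ} (T : FormTable) {p : ℕ × ℕ} (hp : p ∈ sqIndex N) (c : ℂ)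
    (v : ℕ × ℕ → ℂ) :
    sesq N T (fun q => if q = p then c else 0) v
      = c * ∑ r ∈ sqIndex N, conj (v r) * T p.1 p.2 r.2 r.1 := by
  unfold sesq
  rw [Finset.sum_eq_single_of_mem p hp (fun q _ hq => by simp [hq]), Finset.mul_sum]
  exact Finset.sum_congr rfl fun r _ => by simp; ring

lemma sesq_single_right {N : ℕ} (T : FormTable) {r : ℕ × ℕ} (hr : r ∈ sqIndex N) (c : ℂ)
    (u : ℕ × ℕ → ℂ) :
    sesq N T u (fun q => if q = r then c else 0)
      = conj c * ∑ p ∈ sqIndex N, u p * T p.1 p.2 r.2 r.1 := by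
  unfold sesq
  rw [Finset.mul_sum]
  refine Finset.sum_congr rfl fun p _ => ?_
  rw [Finset.sum_eq_single_of_mem r hr (fun q _ hq => by simp [hq])]
  simp; ring

lemma sesq_smul (N : ℕ) (T : FormTable) (c : ℂ) (u : ℕ × ℕ → ℂ) :
    sesq N T (fun p => c * u p) (fun p => c * u p) = c * conj c * sesq N T u u := by
  simp only [sesq, Finset.mul_sum, map_mul]
  exact Finset.sum_congr rfl fun p _ => Finset.sum_congr rfl fun r _ => by ring

lemma sesq_congr {N : ℕ} {S T : FormTable} {u v u' v' : ℕ × ℕ → ℂ}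
    (hT : ∀ i j k l, i < N → j < N → k < N → l < N → S i j k l = T i j k l)
    (hu : ∀ p ∈ sqIndex N, u p = u' p) (hv : ∀ p ∈ sqIndex N, v p = v' p) :
    sesq N S u v = sesq N T u' v' := by
  refine Finset.sum_congr rfl fun p hp => Finset.sum_congr rfl fun r hr => ?_
  have h1 := mem_sqIndex.1 hp
  have h2 := mem_sqIndex.1 hr
  rw [hT _ _ _ _ h1.1 h1.2 h2.2 h2.1, hu p hp, hv r hr]

lemma continuous_sesq (N : ℕ) (T : FormTable) :
    Continuous fun u : ℕ × ℕ → ℂ => (sesq N T u u).re := by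
  unfold sesq
  fun_prop

lemma sqIndex_mono {N N' : ℕ} (h : N ≤ N') : sqIndex N ⊆ sqIndex N' := fun p hp => by
  rw [mem_sqIndex] at hp ⊢
  omega

lemma sesq_of_le {N N' : ℕ} (h : N ≤ N') {T : FormTable} {u v : ℕ × ℕ → ℂ}
    (h1 : ∀ p r, p ∉ sqIndex N → u p * conj (v r) * T p.1 p.2 r.2 r.1 = 0)
    (h2 : ∀ p r, r ∉ sqIndex N → u p * conj (v r) * T p.1 p.2 r.2 r.1 = 0) :
    sesq N' T u v = sesq N T u v := by
  unfold sesq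
  rw [← Finset.sum_subset (sqIndex_mono h)]
  · exact Finset.sum_congr rfl fun p _ =>
      (Finset.sum_subset (sqIndex_mono h) fun r _ hr => h2 p r hr).symm
  · intro p _ hp
    exact Finset.sum_eq_zero fun r _ => h1 p r hp

lemma IsStrict.eq_zero {N : ℕ} {T : FormTable} (h : IsStrict N T) {i j k l : ℕ}
    (hi : N ≤ i ∨ N ≤ j ∨ N ≤ k ∨ N ≤ l) : T i j k l = 0 := by
  rcases hi with hi | hi | hi | hi
  · exact h.supp _ _ _ _ hi
  · rw [h.cyc]; exact h.supp _ _ _ _ hi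
  · rw [h.cyc, h.cyc]; exact h.supp _ _ _ _ hi
  · rw [h.cyc, h.cyc, h.cyc]; exact h.supp _ _ _ _ hi

lemma IsStrict.sesq_of_le {N N' : ℕ} {T : FormTable} (hT : IsStrict N T) (h : N ≤ N')
    (u v : ℕ × ℕ → ℂ) : sesq N' T u v = sesq N T u v := by
  apply FormTable.sesq_of_le h
  · intro p r hp
    rw [mem_sqIndex] at hp
    rw [hT.eq_zero (by omega), mul_zero]
  · intro p r hp
    rw [mem_sqIndex] at hp
    rw [hT.eq_zero (by omega), mul_zero]

/-- A table which is a product along the splitting `(i, j) | (k, l)`. -/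
lemma sesq_split (N : ℕ) (F G : ℕ → ℕ → ℂ) (u v : ℕ × ℕ → ℂ) :
    sesq N (fun i j k l => F i j * G k l) u v
      = (∑ p ∈ sqIndex N, u p * F p.1 p.2) * ∑ r ∈ sqIndex N, conj (v r) * G r.2 r.1 := by
  rw [sesq, Finset.sum_mul_sum]
  exact Finset.sum_congr rfl fun p _ => Finset.sum_congr rfl fun r _ => by ring

lemma sum_sqIndex (N : ℕ) (f : ℕ × ℕ → ℂ) :
    ∑ p ∈ sqIndex N, f p = ∑ i ∈ Finset.range N, ∑ j ∈ Finset.range N, f (i, j) :=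
  Finset.sum_product _ _ _

lemma sum_sqIndex' (N : ℕ) (f : ℕ × ℕ → ℂ) :
    ∑ p ∈ sqIndex N, f p = ∑ j ∈ Finset.range N, ∑ i ∈ Finset.range N, f (i, j) :=
  Finset.sum_product_right _ _ _

/-- Summing over the first index alone already gives zero. The alternative in `h` is needed because
in the applications the contraction of `u` vanishes only for an old index `j`, while for a new `j`
the remaining factor `H` vanishes. -/
lemma sesq_eq_zero_fst {N : ℕ} {α : ℕ → ℂ} {H : ℕ → ℕ → ℕ → ℂ} {T : FormTable}
    {u v : ℕ × ℕ → ℂ}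
    (hT : ∀ i j k l, T i j k l = α i * H j k l)
    (h : ∀ j k l, H j k l = 0 ∨ ∑ i ∈ Finset.range N, α i * u (i, j) = 0) :
    sesq N T u v = 0 := by
  unfold sesq
  rw [Finset.sum_comm]
  refine Finset.sum_eq_zero fun r _ => ?_
  rw [sum_sqIndex']
  refine Finset.sum_eq_zero fun j _ => ?_
  have : ∑ i ∈ Finset.range N, u (i, j) * conj (v r) * T i j r.2 r.1
      = (conj (v r)) * (H j r.2 r.1 * ∑ i ∈ Finset.range N, α i * u (i, j)) := by
    simp only [Finset.mul_sum, hT]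
    exact Finset.sum_congr rfl fun i _ => by ring
  rw [this]
  rcases h j r.2 r.1 with h | h <;> simp [h]

lemma sesq_eq_zero_snd {N : ℕ} {α : ℕ → ℂ} {H : ℕ → ℕ → ℕ → ℂ} {T : FormTable}
    {u v : ℕ × ℕ → ℂ}
    (hT : ∀ i j k l, T i j k l = α j * H i k l)
    (h : ∀ i k l, H i k l = 0 ∨ ∑ j ∈ Finset.range N, α j * u (i, j) = 0) :
    sesq N T u v = 0 := by
  unfold sesq
  rw [Finset.sum_comm]
  refine Finset.sum_eq_zero fun r _ => ?_
  rw [sum_sqIndex]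
  refine Finset.sum_eq_zero fun i _ => ?_
  have : ∑ j ∈ Finset.range N, u (i, j) * conj (v r) * T i j r.2 r.1
      = (conj (v r)) * (H i r.2 r.1 * ∑ j ∈ Finset.range N, α j * u (i, j)) := by
    simp only [Finset.mul_sum, hT]
    exact Finset.sum_congr rfl fun i _ => by ring
  rw [this]
  rcases h i r.2 r.1 with h | h <;> simp [h]

lemma sesq_conj (N : ℕ) (T : FormTable) (u v : ℕ × ℕ → ℂ) :
    conj (sesq N T u v) = sesq N (fun i j k l => conj (T l k j i)) v u := by
  simp only [sesq, map_sum, map_mul, Complex.conj_conj]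
  rw [Finset.sum_comm]
  exact Finset.sum_congr rfl fun p _ => Finset.sum_congr rfl fun r _ => by ring

lemma sesq_eq_zero_thd {N : ℕ} {α : ℕ → ℂ} {H : ℕ → ℕ → ℕ → ℂ} {T : FormTable}
    {u v : ℕ × ℕ → ℂ}
    (hT : ∀ i j k l, T i j k l = α k * H i j l)
    (h : ∀ i j l, H i j l = 0 ∨ ∑ k ∈ Finset.range N, conj (α k) * v (l, k) = 0) :
    sesq N T u v = 0 := by
  -- Conjugation exchanges the two tensors and reverses the word, so the third index becomes the
  -- second.
  rw [← map_eq_zero (starRingEnd ℂ), sesq_conj]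
  refine sesq_eq_zero_snd (α := fun k => conj (α k)) (H := fun i k l => conj (H l k i))
    (fun i j k l => by simp [hT]) fun i k l => ?_
  simpa using h l k i

lemma sesq_eq_zero_fth {N : ℕ} {α : ℕ → ℂ} {H : ℕ → ℕ → ℕ → ℂ} {T : FormTable}
    {u v : ℕ × ℕ → ℂ}
    (hT : ∀ i j k l, T i j k l = α l * H i j k)
    (h : ∀ i j k, H i j k = 0 ∨ ∑ l ∈ Finset.range N, conj (α l) * v (l, k) = 0) :
    sesq N T u v = 0 := by
  rw [← map_eq_zero (starRingEnd ℂ), sesq_conj]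
  refine sesq_eq_zero_fst (α := fun k => conj (α k)) (H := fun i k l => conj (H l k i))
    (fun i j k l => by simp [hT]) fun i k l => ?_
  simpa using h l k i

/-- The matrix of the coordinate projection to the indices in `s`. -/
def diag (s : Finset ℕ) (i j : ℕ) : ℂ := if i = j ∧ j ∈ s then 1 else 0

lemma diag_comm (s : Finset ℕ) (i j : ℕ) : diag s i j = diag s j i := by
  unfold diag
  congr 1
  grind

lemma conj_diag (s : Finset ℕ) (i j : ℕ) : conj (diag s i j) = diag s i j := by
  unfold diag
  split_ifs <;> simp

lemma diag_eq_zero {s : Finset ℕ} {i j : ℕ} (h : i ∉ s ∨ j ∉ s) : diag s i j = 0 := by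
  unfold diag
  grind

/-- A table which is diagonal in the outer indices `l, i` and a rank one square in the inner
indices. -/
lemma sesq_inner_square (N : ℕ) (α : ℕ → ℂ) (s : Finset ℕ) (hs : s ⊆ Finset.range N)
    (u : ℕ × ℕ → ℂ) :
    sesq N (fun i j k l => α j * conj (α k) * diag s l i) u u
      = ((∑ i ∈ s, ‖∑ j ∈ Finset.range N, α j * u (i, j)‖ ^ 2 : ℝ) : ℂ) := by
  have key : ∀ i ∈ Finset.range N, ∀ j, ∑ r ∈ sqIndex N, u (i, j) * conj (u r) *
      (α j * conj (α r.2) * diag s r.1 i)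
      = if i ∈ s then α j * u (i, j) * conj (∑ k ∈ Finset.range N, α k * u (i, k)) else 0 := by
    intro i hi j
    rw [sum_sqIndex, Finset.sum_eq_single_of_mem i hi (fun q _ hq => by simp [diag, hq])]
    split_ifs with h
    · simp only [map_sum, map_mul, Finset.mul_sum]
      exact Finset.sum_congr rfl fun k _ => by simp [diag, h]; ring
    · simp [diag, h]
  unfold sesq
  rw [sum_sqIndex, Finset.sum_congr rfl fun i hi => Finset.sum_congr rfl fun j _ => key i hi j]
  push_cast
  rw [← Finset.sum_subset hs]
  · refine Finset.sum_congr rfl fun i hi => ?_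
    simp only [hi, if_true]
    rw [← Finset.sum_mul, Complex.mul_conj, Complex.normSq_eq_norm_sq]
    push_cast; rfl
  · intro i _ hi
    simp [hi]

/-- A table which is diagonal in the inner indices `j, k` and a rank one square in the outer
indices. -/
lemma sesq_outer_square (N : ℕ) (α : ℕ → ℂ) (s : Finset ℕ) (hs : s ⊆ Finset.range N)
    (u : ℕ × ℕ → ℂ) :
    sesq N (fun i j k l => α i * conj (α l) * diag s j k) u u
      = ((∑ j ∈ s, ‖∑ i ∈ Finset.range N, α i * u (i, j)‖ ^ 2 : ℝ) : ℂ) := by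
  have key : ∀ j ∈ Finset.range N, ∀ i, ∑ r ∈ sqIndex N, u (i, j) * conj (u r) *
      (α i * conj (α r.1) * diag s j r.2)
      = if j ∈ s then α i * u (i, j) * conj (∑ k ∈ Finset.range N, α k * u (k, j)) else 0 := by
    intro j hj i
    rw [sum_sqIndex', Finset.sum_eq_single_of_mem j hj (fun q _ hq => by simp [diag, hq.symm])]
    split_ifs with h
    · simp only [map_sum, map_mul, Finset.mul_sum]
      exact Finset.sum_congr rfl fun k _ => by simp [diag, h]; ring
    · simp [diag, h]
  unfold sesq
  rw [sum_sqIndex', Finset.sum_congr rfl fun j hj => Finset.sum_congr rfl fun i _ => key j hj i]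
  push_cast
  rw [← Finset.sum_subset hs]
  · refine Finset.sum_congr rfl fun i hi => ?_
    simp only [hi, if_true]
    rw [← Finset.sum_mul, Complex.mul_conj, Complex.normSq_eq_norm_sq]
    push_cast; rfl
  · intro i _ hi
    simp [hi]

lemma sesq_diag_mul_diag (N : ℕ) (s : Finset ℕ) (hs : s ⊆ Finset.range N) (u : ℕ × ℕ → ℂ) :
    sesq N (fun i j k l => diag s j k * diag s l i) u u
      = ((∑ p ∈ s ×ˢ s, ‖u p‖ ^ 2 : ℝ) : ℂ) := by
  have key : ∀ p ∈ sqIndex N, ∑ r ∈ sqIndex N, u p * conj (u r) *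
      (diag s p.2 r.2 * diag s r.1 p.1) = if p ∈ s ×ˢ s then u p * conj (u p) else 0 := by
    intro p hp
    rw [Finset.sum_eq_single_of_mem p hp]
    · simp only [diag, true_and, Finset.mem_product]
      split_ifs <;> simp_all
    · intro r _ hr
      have : p.2 ≠ r.2 ∨ r.1 ≠ p.1 := by
        by_contra! h
        exact hr (Prod.ext h.2 h.1.symm)
      rcases this with h | h <;> simp [diag, h]
  unfold sesq
  rw [Finset.sum_congr rfl key, sqIndex, ← Finset.sum_subset (Finset.product_subset_product hs hs)]
  · push_cast
    refine Finset.sum_congr rfl fun p hp => ?_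
    rw [if_pos hp, Complex.mul_conj, Complex.normSq_eq_norm_sq]
    push_cast; rfl
  · intro p _ hp
    rw [if_neg hp]

lemma sesq_diag_diag (N : ℕ) (s : Finset ℕ) (u : ℕ × ℕ → ℂ) :
    sesq N (fun i j k l => diag s i j * diag s k l) u u
      = ((‖∑ p ∈ sqIndex N, u p * diag s p.1 p.2‖ ^ 2 : ℝ) : ℂ) := by
  have : ∑ r ∈ sqIndex N, conj (u r) * diag s r.2 r.1
      = conj (∑ p ∈ sqIndex N, u p * diag s p.1 p.2) := by
    rw [map_sum]
    exact Finset.sum_congr rfl fun r _ => by rw [map_mul, conj_diag, diag_comm]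
  rw [sesq_split, this, Complex.mul_conj, Complex.normSq_eq_norm_sq]

end FormTable

/-! ### Compactness: absorbing indefinite terms by a large multiple -/

/-- If `f` is positive on the zeros of the nonnegative function `g`, both quadratic on a closed
cone of tensors with fixed finite support, then `f + M g` is positive for some `M`. -/
lemma exists_pos_add_mul (J : Finset (ℕ × ℕ)) (X : Set (ℕ × ℕ → ℂ)) (hX : IsClosed X)
    (hsupp : ∀ u ∈ X, ∀ p ∉ J, u p = 0)
    (hcone : ∀ u ∈ X, ∀ r : ℝ, (fun p => (r : ℂ) * u p) ∈ X)
    (f g : (ℕ × ℕ → ℂ) → ℝ) (hf : Continuous f) (hg : Continuous g)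
    (hf2 : ∀ u (r : ℝ), f (fun p => (r : ℂ) * u p) = r ^ 2 * f u)
    (hg2 : ∀ u (r : ℝ), g (fun p => (r : ℂ) * u p) = r ^ 2 * g u)
    (hg0 : ∀ u ∈ X, 0 ≤ g u) (hfg : ∀ u ∈ X, u ≠ 0 → g u = 0 → 0 < f u) :
    ∃ M : ℝ, 0 ≤ M ∧ ∀ u ∈ X, u ≠ 0 → 0 < f u + M * g u := by
  set Y : Set (ℕ × ℕ → ℂ) := X ∩ {u | ∑ p ∈ J, ‖u p‖ ^ 2 = 1} with hY
  have hYne : ∀ u ∈ Y, u ≠ 0 := by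
    rintro u ⟨_, hu⟩ rfl
    simp at hu
  have hYc : IsCompact Y := by
    -- Tychonoff applies in the full product `ℕ × ℕ → ℂ`, since the coordinates off `J` are confined
    -- to a point.
    have hK : IsCompact (Set.univ.pi fun p : ℕ × ℕ => if p ∈ J then Metric.closedBall (0 : ℂ) 1
        else {0}) := by
      refine isCompact_univ_pi fun p => ?_
      split_ifs
      · exact isCompact_closedBall _ _
      · exact isCompact_singleton
    refine hK.of_isClosed_subset
      (hX.inter (isClosed_eq (by fun_prop) continuous_const)) ?_
    rintro u ⟨hu, hn⟩ p _
    dsimp only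
    split_ifs with hp
    · have h1 : ‖u p‖ ^ 2 ≤ 1 := by
        have hn' : ∑ p ∈ J, ‖u p‖ ^ 2 = 1 := hn
        rw [← hn']
        exact Finset.single_le_sum (f := fun p => ‖u p‖ ^ 2) (fun _ _ => by positivity) hp
      rw [mem_closedBall_zero_iff]
      nlinarith [norm_nonneg (u p)]
    · exact hsupp u hu p hp
  have hmain : ∃ M : ℝ, 0 ≤ M ∧ ∀ u ∈ Y, 0 < f u + M * g u := by
    have hZc : IsCompact (Y ∩ {u | f u ≤ 0}) := hYc.inter_right (isClosed_le hf continuous_const)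
    rcases (Y ∩ {u | f u ≤ 0}).eq_empty_or_nonempty with hZ | hZ
    · refine ⟨0, le_rfl, fun u hu => ?_⟩
      by_contra h
      have : u ∈ Y ∩ {u | f u ≤ 0} := ⟨hu, by simpa using h⟩
      simp [hZ] at this
    · obtain ⟨a, ha, hamin⟩ := hZc.exists_isMinOn hZ hg.continuousOn
      obtain ⟨b, hb, hbmin⟩ := hZc.exists_isMinOn hZ hf.continuousOn
      have hga : 0 < g a := by
        refine lt_of_le_of_ne (hg0 a ha.1.1) fun h => ?_
        have h1 := hfg a ha.1.1 (hYne a ha.1) h.symm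
        have h2 : f a ≤ 0 := ha.2
        linarith
      have hfb : f b ≤ 0 := hb.2
      -- Where `f u ≤ 0`, one has `g u ≥ g a` and `f u ≥ f b`, so this constant gives `f u + M * g u
      -- ≥ 1`.
      refine ⟨(1 - f b) / g a, div_nonneg (by linarith) hga.le, fun u hu => ?_⟩
      have hM : 0 ≤ (1 - f b) / g a := div_nonneg (by linarith) hga.le
      by_cases h : f u ≤ 0
      · have h1 : g a ≤ g u := hamin ⟨hu, h⟩
        have h2 : f b ≤ f u := hbmin ⟨hu, h⟩
        have h3 : (1 - f b) / g a * g a ≤ (1 - f b) / g a * g u :=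
          mul_le_mul_of_nonneg_left h1 hM
        rw [div_mul_cancel₀ _ hga.ne'] at h3
        linarith
      · have := mul_nonneg hM (hg0 u hu.1)
        linarith
  obtain ⟨M, hM, hMpos⟩ := hmain
  refine ⟨M, hM, fun u hu hne => ?_⟩
  set s : ℝ := ∑ p ∈ J, ‖u p‖ ^ 2 with hs
  have hspos : 0 < s := by
    obtain ⟨p, hp⟩ := Function.ne_iff.1 hne
    have hpJ : p ∈ J := by
      by_contra h
      exact hp (hsupp u hu p h)
    exact Finset.sum_pos' (fun _ _ => by positivity) ⟨p, hpJ, pow_pos (norm_pos_iff.2 hp) 2⟩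
  have hr : ((Real.sqrt s)⁻¹) ^ 2 = s⁻¹ := by
    rw [inv_pow, Real.sq_sqrt hspos.le]
  have hmem : (fun p => (((Real.sqrt s)⁻¹ : ℝ) : ℂ) * u p) ∈ Y := by
    refine ⟨hcone u hu _, ?_⟩
    show ∑ p ∈ J, ‖(((Real.sqrt s)⁻¹ : ℝ) : ℂ) * u p‖ ^ 2 = 1
    simp only [norm_mul, mul_pow, Complex.norm_real, Real.norm_eq_abs, sq_abs]
    rw [← Finset.mul_sum, hr, ← hs, inv_mul_cancel₀ hspos.ne']
  have h := hMpos _ hmem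
  rw [hf2, hg2, hr] at h
  have : s⁻¹ * f u + M * (s⁻¹ * g u) = s⁻¹ * (f u + M * g u) := by ring
  rw [this] at h
  exact (mul_pos_iff_of_pos_left (inv_pos.2 hspos)).1 h

/-! ### The extension by one complex vector -/

namespace FormTable

/-- The coordinates of the pointed vector, the basis vector of index `0`. -/
def unitCoord (i : ℕ) : ℂ := if i = 0 then 1 else 0

/-- The complex coordinate attached to the two basis vectors of indices `N` and `N + 1`. -/
def newCoord (N i : ℕ) : ℂ := if i = N then 1 else if i = N + 1 then Complex.I else 0

lemma conj_unitCoord (i : ℕ) : conj (unitCoord i) = unitCoord i := by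
  unfold unitCoord
  split_ifs <;> simp

lemma unitCoord_eq_zero {i : ℕ} (h : i ≠ 0) : unitCoord i = 0 := if_neg h

lemma newCoord_of_lt {N i : ℕ} (h : i < N) : newCoord N i = 0 := by
  unfold newCoord
  rw [if_neg (by omega), if_neg (by omega)]

lemma newCoord_of_ge {N i : ℕ} (h : N + 2 ≤ i) : newCoord N i = 0 := by
  unfold newCoord
  rw [if_neg (by omega), if_neg (by omega)]

lemma sum_newCoord (N : ℕ) (f : ℕ → ℂ) :
    ∑ i ∈ Finset.range (N + 2), newCoord N i * f i = f N + Complex.I * f (N + 1) := by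
  rw [Finset.sum_range_succ, Finset.sum_range_succ, Finset.sum_eq_zero]
  · simp [newCoord]
  · intro i hi
    rw [newCoord_of_lt (Finset.mem_range.1 hi), zero_mul]

lemma sum_conj_newCoord (N : ℕ) (f : ℕ → ℂ) :
    ∑ i ∈ Finset.range (N + 2), conj (newCoord N i) * f i = f N - Complex.I * f (N + 1) := by
  rw [Finset.sum_range_succ, Finset.sum_range_succ, Finset.sum_eq_zero]
  · simp [newCoord, sub_eq_add_neg]
  · intro i hi
    rw [newCoord_of_lt (Finset.mem_range.1 hi), map_zero, zero_mul]

lemma sum_unitCoord {N : ℕ} (hN : 0 < N) (f : ℕ → ℂ) :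
    ∑ i ∈ Finset.range N, unitCoord i * f i = f 0 := by
  rw [Finset.sum_eq_single_of_mem 0 (Finset.mem_range.2 hN)]
  · simp [unitCoord]
  · intro i _ hi
    rw [unitCoord_eq_zero hi, zero_mul]

/-- The extension of the table `T` by the values forced by `y ⊗ 1 ≈ e a ⊗ e b`, where `y` is the
complex vector dual to `newCoord N`. -/
def productTable (N : ℕ) (T : FormTable) (a b : ℕ) (η : ℝ) : FormTable := fun i j k l =>
  T i j k l
  + newCoord N i * unitCoord j * T a b k l
  + newCoord N j * unitCoord k * T a b l i
  + newCoord N k * unitCoord l * T a b i j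
  + newCoord N l * unitCoord i * T a b j k
  + conj (newCoord N i) * unitCoord l * T j k b a
  + conj (newCoord N j) * unitCoord i * T k l b a
  + conj (newCoord N k) * unitCoord j * T l i b a
  + conj (newCoord N l) * unitCoord k * T i j b a
  + newCoord N i * unitCoord j * (newCoord N k * unitCoord l * T a b a b)
  + newCoord N j * unitCoord i * (newCoord N l * unitCoord k * T a b a b)
  + conj (newCoord N i) * unitCoord j * (conj (newCoord N k) * unitCoord l * T b a b a)
  + conj (newCoord N j) * unitCoord i * (conj (newCoord N l) * unitCoord k * T b a b a)
  + newCoord N i * unitCoord j * (conj (newCoord N l) * unitCoord k * (T a b b a + η))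
  + newCoord N j * conj (newCoord N i) * (unitCoord k * unitCoord l * (T a b b a + η))
  + conj (newCoord N j) * unitCoord i * (newCoord N k * unitCoord l * (T a b b a + η))
  + unitCoord i * unitCoord j * (newCoord N l * conj (newCoord N k) * (T a b b a + η))

/-- The table giving mass to the products of old and new vectors, other than `y ⊗ 1` and its
adjoint `1 ⊗ y*`. -/
def mixedTable (N : ℕ) : FormTable := fun i j k l =>
  newCoord N i * conj (newCoord N j) * diag (Finset.range N) k l
  + conj (newCoord N i) * newCoord N j * diag ((Finset.range N).erase 0) k l
  + newCoord N j * conj (newCoord N k) * diag (Finset.range N) l i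
  + conj (newCoord N j) * newCoord N k * diag ((Finset.range N).erase 0) l i
  + diag (Finset.range N) i j * (newCoord N k * conj (newCoord N l))
  + diag ((Finset.range N).erase 0) i j * (conj (newCoord N k) * newCoord N l)
  + conj (newCoord N i) * newCoord N l * diag (Finset.range N) j k
  + newCoord N i * conj (newCoord N l) * diag ((Finset.range N).erase 0) j k

/-- The table giving mass to the products of two new vectors. -/
def newTable (N : ℕ) : FormTable := fun i j k l =>
  diag {N, N + 1} i j * diag {N, N + 1} k l + diag {N, N + 1} j k * diag {N, N + 1} l i

/-- The table of the extension by one complex vector. -/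
def stepTable (N : ℕ) (T : FormTable) (a b : ℕ) (η M M' : ℝ) : FormTable := fun i j k l =>
  productTable N T a b η i j k l + M * mixedTable N i j k l + M' * newTable N i j k l

section

variable {N : ℕ} {T : FormTable} {a b : ℕ} {η : ℝ} {u : ℕ × ℕ → ℂ}

/-- The summands of the three tables come in complete orbits under rotation of the word, and these
are also stable under reversal with conjugation; this accounts for the number of terms in
`productTable` and `mixedTable`. -/
lemma stepTable_cyc (hT : IsStrict N T) (M M' : ℝ) (i j k l : ℕ) :
    stepTable N T a b η M M' i j k l = stepTable N T a b η M M' j k l i := by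
  simp only [stepTable, productTable, mixedTable, newTable]
  rw [hT.cyc i j k l, hT.cyc b a b a]
  ring

lemma stepTable_herm (hT : IsStrict N T) (M M' : ℝ) (i j k l : ℕ) :
    stepTable N T a b η M M' i j k l = conj (stepTable N T a b η M M' l k j i) := by
  simp only [stepTable, productTable, mixedTable, newTable, map_add, map_mul, Complex.conj_conj,
    conj_unitCoord, conj_diag, Complex.conj_ofReal, ← hT.herm]
  simp only [diag_comm _ j i, diag_comm _ k j, diag_comm _ l k, diag_comm _ i l]
  ring

lemma stepTable_of_ge (hT : IsStrict N T) (M M' : ℝ) (i j k l : ℕ) (hi : N + 2 ≤ i) :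
    stepTable N T a b η M M' i j k l = 0 := by
  have h1 : newCoord N i = 0 := newCoord_of_ge hi
  have h2 : unitCoord i = 0 := unitCoord_eq_zero (by omega)
  have h3 : i ∉ Finset.range N := by simp; omega
  have h4 : i ∉ (Finset.range N).erase 0 := by simp; omega
  have h5 : i ∉ ({N, N + 1} : Finset ℕ) := by simp; omega
  have h6 : ∀ m, diag (Finset.range N) m i = 0 := fun m => diag_eq_zero (.inr h3)
  have h7 : ∀ m, diag ((Finset.range N).erase 0) m i = 0 := fun m => diag_eq_zero (.inr h4)
  have h8 : ∀ m, diag {N, N + 1} m i = 0 := fun m => diag_eq_zero (.inr h5)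
  have t1 : T i j k l = 0 := hT.eq_zero (by omega)
  have t2 : T a b l i = 0 := hT.eq_zero (by omega)
  have t3 : T a b i j = 0 := hT.eq_zero (by omega)
  have t4 : T l i b a = 0 := hT.eq_zero (by omega)
  have t5 : T i j b a = 0 := hT.eq_zero (by omega)
  simp only [stepTable, productTable, mixedTable, newTable, h1, h2, h6, h7, h8, t1, t2, t3, t4, t5,
    diag_comm _ i j, map_zero, mul_zero, zero_mul, add_zero]

lemma stepTable_of_lt (M M' : ℝ) {i j k l : ℕ} (hi : i < N) (hj : j < N) (hk : k < N)
    (hl : l < N) : stepTable N T a b η M M' i j k l = T i j k l := by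
  have h8 : ∀ m, diag {N, N + 1} i m = 0 := fun m => diag_eq_zero (.inl (by simp; omega))
  simp only [stepTable, productTable, mixedTable, newTable, newCoord_of_lt hi, newCoord_of_lt hj,
    newCoord_of_lt hk, newCoord_of_lt hl, h8, diag_comm _ l i, map_zero, mul_zero, zero_mul,
    add_zero]

lemma newCoord_mul_newCoord_mul (hu : ∀ i j, N ≤ i → N ≤ j → u (i, j) = 0) (p : ℕ × ℕ) :
    newCoord N p.1 * newCoord N p.2 * u p = 0 := by
  rcases lt_or_ge p.1 N with h | h
  · simp [newCoord_of_lt h]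
  rcases lt_or_ge p.2 N with h' | h'
  · simp [newCoord_of_lt h']
  rw [hu p.1 p.2 h h', mul_zero]

lemma newCoord_eq_zero_or (hu : ∀ i j, N ≤ i → N ≤ j → u (i, j) = 0) (p : ℕ × ℕ) :
    newCoord N p.1 = 0 ∨ newCoord N p.2 = 0 ∨ u p = 0 := by
  simpa [or_assoc] using newCoord_mul_newCoord_mul hu p

/-- The quadratic form of `mixedTable` on tensors without component on products of new vectors. -/
lemma sesq_mixedTable (hu : ∀ i j, N ≤ i → N ≤ j → u (i, j) = 0) :
    sesq (N + 2) (mixedTable N) u u =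
      ((∑ i ∈ Finset.range N, ‖∑ j ∈ Finset.range (N + 2), newCoord N j * u (i, j)‖ ^ 2
      + ∑ i ∈ (Finset.range N).erase 0,
          ‖∑ j ∈ Finset.range (N + 2), conj (newCoord N j) * u (i, j)‖ ^ 2
      + ∑ j ∈ Finset.range N, ‖∑ i ∈ Finset.range (N + 2), conj (newCoord N i) * u (i, j)‖ ^ 2
      + ∑ j ∈ (Finset.range N).erase 0,
          ‖∑ i ∈ Finset.range (N + 2), newCoord N i * u (i, j)‖ ^ 2 : ℝ) : ℂ) := by
  have hs : Finset.range N ⊆ Finset.range (N + 2) := Finset.range_mono (by omega)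
  have hs' : (Finset.range N).erase 0 ⊆ Finset.range (N + 2) :=
    (Finset.erase_subset _ _).trans hs
  have i1 := sesq_inner_square (N + 2) (newCoord N) _ hs u
  have i2 := sesq_inner_square (N + 2) (fun i => conj (newCoord N i)) _ hs' u
  have o1 := sesq_outer_square (N + 2) (fun i => conj (newCoord N i)) _ hs u
  have o2 := sesq_outer_square (N + 2) (newCoord N) _ hs' u
  simp only [Complex.conj_conj] at i2 o1
  unfold mixedTable
  simp only [sesq_add_table]
  rw [i1, i2, o1, o2]
  rw [sesq_split _ (fun i j => newCoord N i * conj (newCoord N j)),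
    sesq_split _ (fun i j => conj (newCoord N i) * newCoord N j),
    sesq_split _ (fun i j => diag (Finset.range N) i j)
      (fun k l => newCoord N k * conj (newCoord N l)),
    sesq_split _ (fun i j => diag ((Finset.range N).erase 0) i j)
      (fun k l => conj (newCoord N k) * newCoord N l)]
  -- The four rotated terms left over place both new indices in the same tensor, where `u` has no
  -- component.
  rw [Finset.sum_eq_zero (f := fun p => u p * (newCoord N p.1 * conj (newCoord N p.2))),
    Finset.sum_eq_zero (f := fun p => u p * (conj (newCoord N p.1) * newCoord N p.2)),
    Finset.sum_eq_zero (f := fun p => conj (u p) * (newCoord N p.2 * conj (newCoord N p.1))),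
    Finset.sum_eq_zero (f := fun p => conj (u p) * (conj (newCoord N p.2) * newCoord N p.1))]
  · push_cast
    ring
  all_goals
    intro p _
    rcases newCoord_eq_zero_or hu p with h | h | h <;> simp [h]

lemma sesq_newTable :
    sesq (N + 2) (newTable N) u u =
      ((‖∑ p ∈ sqIndex (N + 2), u p * diag {N, N + 1} p.1 p.2‖ ^ 2
      + ∑ p ∈ ({N, N + 1} : Finset ℕ) ×ˢ ({N, N + 1} : Finset ℕ), ‖u p‖ ^ 2 : ℝ) : ℂ) := by
  have hs : ({N, N + 1} : Finset ℕ) ⊆ Finset.range (N + 2) := by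
    intro i hi
    simp at hi ⊢
    omega
  unfold newTable
  rw [sesq_add_table, sesq_diag_diag, sesq_diag_mul_diag _ _ hs, Complex.ofReal_add]

/-- The coefficient of `u` at `y ⊗ 1`. -/
def coeffLeft (N : ℕ) (u : ℕ × ℕ → ℂ) : ℂ := u (N, 0) + Complex.I * u (N + 1, 0)

/-- The coefficient of `u` at `1 ⊗ y*`. -/
def coeffRight (N : ℕ) (u : ℕ × ℕ → ℂ) : ℂ := u (0, N) - Complex.I * u (0, N + 1)

/-- The tensor obtained from `u` by the replacements of `y ⊗ 1` by `e a ⊗ e b` and of `1 ⊗ y*` by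
`e b ⊗ e a`. -/
def reduce (N a b : ℕ) (u : ℕ × ℕ → ℂ) : ℕ × ℕ → ℂ := fun p =>
  u p + ((if p = (a, b) then coeffLeft N u else 0) + (if p = (b, a) then coeffRight N u else 0))

lemma sum_coeffLeft (u : ℕ × ℕ → ℂ) :
    ∑ p ∈ sqIndex (N + 2), u p * (newCoord N p.1 * unitCoord p.2) = coeffLeft N u := by
  rw [sum_sqIndex', coeffLeft]
  have h := sum_unitCoord (N := N + 2) (by omega)
    fun j => ∑ i ∈ Finset.range (N + 2), newCoord N i * u (i, j)
  rw [sum_newCoord] at h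
  rw [← h]
  refine Finset.sum_congr rfl fun j _ => ?_
  rw [Finset.mul_sum]
  exact Finset.sum_congr rfl fun i _ => by ring

lemma sum_coeffRight (u : ℕ × ℕ → ℂ) :
    ∑ p ∈ sqIndex (N + 2), u p * (conj (newCoord N p.2) * unitCoord p.1) = coeffRight N u := by
  rw [sum_sqIndex, coeffRight]
  have h := sum_unitCoord (N := N + 2) (by omega)
    fun i => ∑ j ∈ Finset.range (N + 2), conj (newCoord N j) * u (i, j)
  rw [sum_conj_newCoord] at h
  rw [← h]
  refine Finset.sum_congr rfl fun j _ => ?_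
  rw [Finset.mul_sum]
  exact Finset.sum_congr rfl fun i _ => by ring

/-- Expanding the square produces exactly the terms that `productTable` contributes through `y ⊗ 1`
and `1 ⊗ y*`. -/
lemma sesq_reduce (hT : IsStrict N T) (ha : a < N) (hb : b < N) :
    sesq N T (reduce N a b u) (reduce N a b u) = sesq (N + 2) T u u
      + coeffLeft N u * ∑ r ∈ sqIndex (N + 2), conj (u r) * T a b r.2 r.1
      + coeffRight N u * ∑ r ∈ sqIndex (N + 2), conj (u r) * T b a r.2 r.1
      + conj (coeffLeft N u) * ∑ p ∈ sqIndex (N + 2), u p * T p.1 p.2 b a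
      + conj (coeffRight N u) * ∑ p ∈ sqIndex (N + 2), u p * T p.1 p.2 a b
      + coeffLeft N u * conj (coeffLeft N u) * T a b b a
      + coeffLeft N u * conj (coeffRight N u) * T a b a b
      + coeffRight N u * conj (coeffLeft N u) * T b a b a
      + coeffRight N u * conj (coeffRight N u) * T b a a b := by
  have hab : (a, b) ∈ sqIndex (N + 2) := mem_sqIndex.2 ⟨by simp; omega, by simp; omega⟩
  have hba : (b, a) ∈ sqIndex (N + 2) := mem_sqIndex.2 ⟨by simp; omega, by simp; omega⟩
  rw [← hT.sesq_of_le (show N ≤ N + 2 by omega)]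
  unfold reduce
  simp only [sesq_add_left, sesq_add_right, sesq_single_left T hab, sesq_single_left T hba,
    sesq_single_right T hab, sesq_single_right T hba]
  have hd : ∀ (m : ℕ × ℕ) (c : ℂ) (f : ℕ × ℕ → ℂ), m ∈ sqIndex (N + 2) →
      ∑ r ∈ sqIndex (N + 2), (if r = m then c else 0) * f r = c * f m := by
    intro m c f hm
    rw [Finset.sum_eq_single_of_mem m hm (fun q _ hq => by simp [hq])]
    simp
  simp only [add_mul, Finset.sum_add_distrib]
  rw [hd (a, b) _ (fun r => T r.1 r.2 b a) hab, hd (b, a) _ (fun r => T r.1 r.2 b a) hba,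
    hd (a, b) _ (fun r => T r.1 r.2 a b) hab, hd (b, a) _ (fun r => T r.1 r.2 a b) hba]
  ring

/-- Apart from `T`, the table has sixteen summands. Eight vanish (`z1` to `z8`): they read a
coordinate of `u` at `y` in the second slot or at `y*` in the first, excluded by `hR` and `hL`, or
at a product of two new vectors. The other eight (`k1` to `k8`) complete the square of `reduce`, and
the surplus `η` remains on the two coefficients. -/
lemma sesq_productTable (hT : IsStrict N T) (ha : a < N) (hb : b < N)
    (hu : ∀ i j, N ≤ i → N ≤ j → u (i, j) = 0)
    (hR : ∀ i < N, ∑ j ∈ Finset.range (N + 2), newCoord N j * u (i, j) = 0)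
    (hL : ∀ j < N, ∑ i ∈ Finset.range (N + 2), conj (newCoord N i) * u (i, j) = 0) :
    sesq (N + 2) (productTable N T a b η) u u
      = sesq N T (reduce N a b u) (reduce N a b u)
        + ((η * (‖coeffLeft N u‖ ^ 2 + ‖coeffRight N u‖ ^ 2) : ℝ) : ℂ) := by
  have z1 : sesq (N + 2) (fun i j k l => newCoord N j * unitCoord k * T a b l i) u u = 0 := by
    refine sesq_eq_zero_snd (H := fun i k l => unitCoord k * T a b l i)
      (fun i j k l => mul_assoc _ _ _) fun i k l => ?_
    rcases lt_or_ge i N with h | h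
    · exact .inr (hR i h)
    · exact .inl (by rw [hT.eq_zero (by omega), mul_zero])
  have z2 : sesq (N + 2) (fun i j k l => newCoord N l * unitCoord i * T a b j k) u u = 0 := by
    refine sesq_eq_zero_fth (H := fun i j k => unitCoord i * T a b j k)
      (fun i j k l => mul_assoc _ _ _) fun i j k => ?_
    rcases lt_or_ge k N with h | h
    · exact .inr (hL k h)
    · exact .inl (by rw [hT.eq_zero (by omega), mul_zero])
  have z3 : sesq (N + 2) (fun i j k l => conj (newCoord N i) * unitCoord l * T j k b a) u u
      = 0 := by
    refine sesq_eq_zero_fst (α := fun i => conj (newCoord N i))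
      (H := fun j k l => unitCoord l * T j k b a)
      (fun i j k l => mul_assoc _ _ _) fun j k l => ?_
    rcases lt_or_ge j N with h | h
    · exact .inr (hL j h)
    · exact .inl (by rw [hT.eq_zero (by omega), mul_zero])
  have z4 : sesq (N + 2) (fun i j k l => conj (newCoord N k) * unitCoord j * T l i b a) u u
      = 0 := by
    refine sesq_eq_zero_thd (α := fun i => conj (newCoord N i))
      (H := fun i j l => unitCoord j * T l i b a)
      (fun i j k l => mul_assoc _ _ _) fun i j l => ?_
    rcases lt_or_ge l N with h | h
    · exact .inr (by simpa using hR l h)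
    · exact .inl (by rw [hT.eq_zero (by omega), mul_zero])
  have z5 : sesq (N + 2) (fun i j k l => newCoord N j * unitCoord i *
      (newCoord N l * unitCoord k * T a b a b)) u u = 0 := by
    refine sesq_eq_zero_snd (H := fun i k l => unitCoord i *
      (newCoord N l * unitCoord k * T a b a b)) (fun i j k l => mul_assoc _ _ _) fun i k l => ?_
    rcases lt_or_ge i N with h | h
    · exact .inr (hR i h)
    · exact .inl (by rw [unitCoord_eq_zero (by omega), zero_mul])
  have z6 : sesq (N + 2) (fun i j k l => conj (newCoord N i) * unitCoord j *
      (conj (newCoord N k) * unitCoord l * T b a b a)) u u = 0 := by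
    refine sesq_eq_zero_fst (α := fun i => conj (newCoord N i)) (H := fun j k l => unitCoord j *
      (conj (newCoord N k) * unitCoord l * T b a b a)) (fun i j k l => mul_assoc _ _ _)
      fun j k l => ?_
    rcases lt_or_ge j N with h | h
    · exact .inr (hL j h)
    · exact .inl (by rw [unitCoord_eq_zero (by omega), zero_mul])
  have z7 : sesq (N + 2) (fun i j k l => newCoord N j * conj (newCoord N i) *
      (unitCoord k * unitCoord l * (T a b b a + η))) u u = 0 := by
    rw [sesq_split _ (fun i j => newCoord N j * conj (newCoord N i))
      (fun k l => unitCoord k * unitCoord l * (T a b b a + η)), Finset.sum_eq_zero, zero_mul]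
    intro p _
    rcases newCoord_eq_zero_or hu p with h | h | h <;> simp [h]
  have z8 : sesq (N + 2) (fun i j k l => unitCoord i * unitCoord j *
      (newCoord N l * conj (newCoord N k) * (T a b b a + η))) u u = 0 := by
    rw [sesq_split _ (fun i j => unitCoord i * unitCoord j)
      (fun k l => newCoord N l * conj (newCoord N k) * (T a b b a + η)),
      Finset.sum_eq_zero (f := fun r => conj (u r) * _), mul_zero]
    intro p _
    rcases newCoord_eq_zero_or hu p with h | h | h <;> simp [h]
  have cL := sum_coeffLeft (N := N) u
  have cR := sum_coeffRight (N := N) u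
  have cL' : ∀ c, ∑ r ∈ sqIndex (N + 2), conj (u r) * (conj (newCoord N r.1) * unitCoord r.2 * c)
      = conj (coeffLeft N u) * c := by
    intro c
    rw [← cL, map_sum, Finset.sum_mul]
    exact Finset.sum_congr rfl fun r _ => by simp only [map_mul, conj_unitCoord]; ring
  have cR' : ∀ c, ∑ r ∈ sqIndex (N + 2), conj (u r) * (newCoord N r.2 * unitCoord r.1 * c)
      = conj (coeffRight N u) * c := by
    intro c
    rw [← cR, map_sum, Finset.sum_mul]
    exact Finset.sum_congr rfl fun r _ => by
      simp only [map_mul, conj_unitCoord, Complex.conj_conj]; ring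
  have k1 : sesq (N + 2) (fun i j k l => newCoord N i * unitCoord j * T a b k l) u u
      = coeffLeft N u * ∑ r ∈ sqIndex (N + 2), conj (u r) * T a b r.2 r.1 := by
    rw [sesq_split _ (fun i j => newCoord N i * unitCoord j), cL]
  have k2 : sesq (N + 2) (fun i j k l => newCoord N k * unitCoord l * T a b i j) u u
      = conj (coeffRight N u) * ∑ p ∈ sqIndex (N + 2), u p * T p.1 p.2 a b := by
    have h1 : (fun i j k l => newCoord N k * unitCoord l * T a b i j)
        = fun i j k l => T i j a b * (newCoord N k * unitCoord l * 1) := by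
      funext i j k l
      rw [hT.cyc i j, hT.cyc j a]; ring
    rw [h1, sesq_split _ (fun i j => T i j a b) (fun k l => newCoord N k * unitCoord l * 1), cR']
    ring
  have k3 : sesq (N + 2) (fun i j k l => conj (newCoord N j) * unitCoord i * T k l b a) u u
      = coeffRight N u * ∑ r ∈ sqIndex (N + 2), conj (u r) * T b a r.2 r.1 := by
    rw [sesq_split _ (fun i j => conj (newCoord N j) * unitCoord i) (fun k l => T k l b a), cR]
    congr 1
    exact Finset.sum_congr rfl fun r _ => by rw [hT.cyc b a, hT.cyc a]
  have k4 : sesq (N + 2) (fun i j k l => conj (newCoord N l) * unitCoord k * T i j b a) u u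
      = conj (coeffLeft N u) * ∑ p ∈ sqIndex (N + 2), u p * T p.1 p.2 b a := by
    have h1 : (fun i j k l => conj (newCoord N l) * unitCoord k * T i j b a)
        = fun i j k l => T i j b a * (conj (newCoord N l) * unitCoord k * 1) := by
      funext i j k l
      ring
    rw [h1, sesq_split _ (fun i j => T i j b a)
      (fun k l => conj (newCoord N l) * unitCoord k * 1), cL']
    ring
  have k5 : sesq (N + 2) (fun i j k l => newCoord N i * unitCoord j *
      (newCoord N k * unitCoord l * T a b a b)) u u
      = coeffLeft N u * (conj (coeffRight N u) * T a b a b) := by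
    rw [sesq_split _ (fun i j => newCoord N i * unitCoord j)
      (fun k l => newCoord N k * unitCoord l * T a b a b), cL, cR']
  have k6 : sesq (N + 2) (fun i j k l => conj (newCoord N j) * unitCoord i *
      (conj (newCoord N l) * unitCoord k * T b a b a)) u u
      = coeffRight N u * (conj (coeffLeft N u) * T b a b a) := by
    rw [sesq_split _ (fun i j => conj (newCoord N j) * unitCoord i)
      (fun k l => conj (newCoord N l) * unitCoord k * T b a b a), cR, cL']
  have k7 : sesq (N + 2) (fun i j k l => newCoord N i * unitCoord j *
      (conj (newCoord N l) * unitCoord k * (T a b b a + η))) u u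
      = coeffLeft N u * (conj (coeffLeft N u) * (T a b b a + η)) := by
    rw [sesq_split _ (fun i j => newCoord N i * unitCoord j)
      (fun k l => conj (newCoord N l) * unitCoord k * (T a b b a + η)), cL, cL']
  have k8 : sesq (N + 2) (fun i j k l => conj (newCoord N j) * unitCoord i *
      (newCoord N k * unitCoord l * (T a b b a + η))) u u
      = coeffRight N u * (conj (coeffRight N u) * (T a b b a + η)) := by
    rw [sesq_split _ (fun i j => conj (newCoord N j) * unitCoord i)
      (fun k l => newCoord N k * unitCoord l * (T a b b a + η)), cR, cR']
  have hsq : ∀ z : ℂ, ((‖z‖ ^ 2 : ℝ) : ℂ) = z * conj z := fun z => by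
    rw [Complex.mul_conj, Complex.normSq_eq_norm_sq]
  unfold productTable
  simp only [sesq_add_table]
  rw [z1, z2, z3, z4, z5, z6, z7, z8, k1, k2, k3, k4, k5, k6, k7, k8, sesq_reduce hT ha hb,
    Complex.ofReal_mul, Complex.ofReal_add, hsq, hsq, hT.cyc b a a b, hT.cyc a a b b]
  ring

/-- A zero of the mixed form has no mixed coordinates except those at `y ⊗ 1` and `1 ⊗ y*`. Either
the reduced tensor is nonzero and `T` is positive on it, or one of these two coefficients is nonzero
and the surplus `η` counts; otherwise `u` itself vanishes. -/
lemma sesq_productTable_pos (hN : 0 < N) (hT : IsStrict N T) (ha : a < N) (hb : b < N)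
    (hη : 0 < η) (hsupp : ∀ p ∉ sqIndex (N + 2), u p = 0)
    (hu : ∀ i j, N ≤ i → N ≤ j → u (i, j) = 0)
    (hmix : (sesq (N + 2) (mixedTable N) u u).re = 0) (hne : u ≠ 0) :
    0 < (sesq (N + 2) (productTable N T a b η) u u).re := by
  rw [sesq_mixedTable hu, Complex.ofReal_re] at hmix
  have n1 : 0 ≤ ∑ i ∈ Finset.range N,
      ‖∑ j ∈ Finset.range (N + 2), newCoord N j * u (i, j)‖ ^ 2 := by positivity
  have n2 : 0 ≤ ∑ i ∈ (Finset.range N).erase 0,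
      ‖∑ j ∈ Finset.range (N + 2), conj (newCoord N j) * u (i, j)‖ ^ 2 := by positivity
  have n3 : 0 ≤ ∑ j ∈ Finset.range N,
      ‖∑ i ∈ Finset.range (N + 2), conj (newCoord N i) * u (i, j)‖ ^ 2 := by positivity
  have n4 : 0 ≤ ∑ j ∈ (Finset.range N).erase 0,
      ‖∑ i ∈ Finset.range (N + 2), newCoord N i * u (i, j)‖ ^ 2 := by positivity
  have e1 := (Finset.sum_eq_zero_iff_of_nonneg fun _ _ => by positivity).1
    (show ∑ i ∈ Finset.range N,
      ‖∑ j ∈ Finset.range (N + 2), newCoord N j * u (i, j)‖ ^ 2 = 0 by linarith)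
  have e2 := (Finset.sum_eq_zero_iff_of_nonneg fun _ _ => by positivity).1
    (show ∑ i ∈ (Finset.range N).erase 0,
      ‖∑ j ∈ Finset.range (N + 2), conj (newCoord N j) * u (i, j)‖ ^ 2 = 0 by linarith)
  have e3 := (Finset.sum_eq_zero_iff_of_nonneg fun _ _ => by positivity).1
    (show ∑ j ∈ Finset.range N,
      ‖∑ i ∈ Finset.range (N + 2), conj (newCoord N i) * u (i, j)‖ ^ 2 = 0 by linarith)
  have e4 := (Finset.sum_eq_zero_iff_of_nonneg fun _ _ => by positivity).1
    (show ∑ j ∈ (Finset.range N).erase 0,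
      ‖∑ i ∈ Finset.range (N + 2), newCoord N i * u (i, j)‖ ^ 2 = 0 by linarith)
  simp only [Finset.mem_range, Finset.mem_erase, ne_eq, OfNat.ofNat_ne_zero, not_false_eq_true,
    pow_eq_zero_iff, norm_eq_zero] at e1 e2 e3 e4
  rw [sesq_productTable hT ha hb hu e1 e3, Complex.add_re, Complex.ofReal_re]
  by_cases hred : ∃ p ∈ sqIndex N, reduce N a b u p ≠ 0
  · have := hT.pos _ hred
    positivity
  push Not at hred
  have h0 : sesq N T (reduce N a b u) (reduce N a b u) = 0 := by
    unfold sesq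
    exact Finset.sum_eq_zero fun p hp => Finset.sum_eq_zero fun r _ => by
      rw [hred p hp, zero_mul, zero_mul]
  rw [h0, Complex.zero_re, zero_add]
  refine mul_pos hη ?_
  by_contra hcoeff
  have hc1 : coeffLeft N u = 0 := by
    rw [← norm_eq_zero]
    nlinarith [sq_nonneg ‖coeffLeft N u‖, sq_nonneg ‖coeffRight N u‖]
  have hc2 : coeffRight N u = 0 := by
    rw [← norm_eq_zero]
    nlinarith [sq_nonneg ‖coeffLeft N u‖, sq_nonneg ‖coeffRight N u‖]
  -- The coordinates along `y` and `y*` together determine those along `e N` and `e (N + 1)`.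
  have hpm : ∀ z w : ℂ, z + Complex.I * w = 0 → z - Complex.I * w = 0 → z = 0 ∧ w = 0 := by
    intro z w h1 h2
    have hz : z = 0 := by linear_combination (h1 + h2) / 2
    refine ⟨hz, ?_⟩
    have : Complex.I * w = 0 := by linear_combination (h1 - h2) / 2
    simpa using this
  have hright : ∀ i < N, u (i, N) = 0 ∧ u (i, N + 1) = 0 := by
    intro i hi
    refine hpm _ _ ?_ ?_
    · rw [← sum_newCoord N fun j => u (i, j)]
      exact e1 i hi
    · rcases eq_or_ne i 0 with rfl | h
      · exact hc2
      · rw [← sum_conj_newCoord N fun j => u (i, j)]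
        exact e2 i ⟨h, hi⟩
  have hleft : ∀ j < N, u (N, j) = 0 ∧ u (N + 1, j) = 0 := by
    intro j hj
    refine hpm _ _ ?_ ?_
    · rcases eq_or_ne j 0 with rfl | h
      · exact hc1
      · rw [← sum_newCoord N fun i => u (i, j)]
        exact e4 j ⟨h, hj⟩
    · rw [← sum_conj_newCoord N fun i => u (i, j)]
      exact e3 j hj
  apply hne
  funext ⟨i, j⟩
  rw [Pi.zero_apply]
  by_cases hp : (i, j) ∈ sqIndex (N + 2)
  swap
  · exact hsupp _ hp
  rw [mem_sqIndex] at hp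
  dsimp only at hp
  rcases lt_or_ge i N with hi | hi <;> rcases lt_or_ge j N with hj | hj
  · have := hred (i, j) (mem_sqIndex.2 ⟨hi, hj⟩)
    simpa [reduce, hc1, hc2] using this
  · obtain rfl | rfl : j = N ∨ j = N + 1 := by omega
    · exact (hright i hi).1
    · exact (hright i hi).2
  · obtain rfl | rfl : i = N ∨ i = N + 1 := by omega
    · exact (hleft j hj).1
    · exact (hleft j hj).2
  · exact hu i j hi hj

/-- The tensor `e a ⊗ e b - y ⊗ 1`. -/
def defect (N a b : ℕ) : ℕ × ℕ → ℂ := fun p =>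
  (if p = (a, b) then 1 else 0)
    + ((if p = (N, 0) then -(1 / 2) else 0) + (if p = (N + 1, 0) then Complex.I / 2 else 0))

/-- Here `y = (e N - i e (N + 1)) / 2`, so the defect has coefficient `-1` at `y ⊗ 1`, none at `1 ⊗
y*`, and reduces to zero. It is invisible to the mixed and new tables, hence the value `η` whatever
the masses. -/
lemma sesq_defect (hN : 0 < N) (hT : IsStrict N T) (ha : a < N) (hb : b < N) (M M' : ℝ) :
    sesq (N + 2) (stepTable N T a b η M M') (defect N a b) (defect N a b) = η := by
  set u := defect N a b with hu'
  have hval : ∀ i j, u (i, j) = (if i = a ∧ j = b then 1 else 0)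
      + ((if i = N ∧ j = 0 then -(1 / 2) else 0)
        + (if i = N + 1 ∧ j = 0 then Complex.I / 2 else 0)) := by
    intro i j
    simp [hu', defect, Prod.ext_iff]
  have hu : ∀ i j, N ≤ i → N ≤ j → u (i, j) = 0 := by
    intro i j hi hj
    rw [hval, if_neg (by omega), if_neg (by omega), if_neg (by omega)]
    simp
  have hright : ∀ i j, N ≤ j → u (i, j) = 0 := by
    intro i j hj
    rw [hval, if_neg (by omega), if_neg (by omega), if_neg (by omega)]
    simp
  have hleft : ∀ j ≠ 0, u (N, j) = 0 ∧ u (N + 1, j) = 0 := by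
    intro j hj
    rw [hval, hval, if_neg (by omega), if_neg (by omega), if_neg (by omega), if_neg (by omega),
      if_neg (by omega), if_neg (by omega)]
    simp
  have h0 : u (N, 0) = -(1 / 2) ∧ u (N + 1, 0) = Complex.I / 2 := by
    rw [hval, hval, if_neg (by omega), if_pos (by omega), if_neg (by omega), if_neg (by omega),
      if_neg (by omega), if_pos (by omega)]
    simp
  have hI := Complex.I_mul_I
  have e1 : ∀ i < N, ∑ j ∈ Finset.range (N + 2), newCoord N j * u (i, j) = 0 := by
    intro i _
    rw [sum_newCoord N fun j => u (i, j), hright i N le_rfl, hright i (N + 1) (by omega)]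
    simp
  have e2 : ∀ i < N, ∑ j ∈ Finset.range (N + 2), conj (newCoord N j) * u (i, j) = 0 := by
    intro i _
    rw [sum_conj_newCoord N fun j => u (i, j), hright i N le_rfl, hright i (N + 1) (by omega)]
    simp
  have e3 : ∀ j < N, ∑ i ∈ Finset.range (N + 2), conj (newCoord N i) * u (i, j) = 0 := by
    intro j _
    rw [sum_conj_newCoord N fun i => u (i, j)]
    rcases eq_or_ne j 0 with rfl | hj
    · rw [h0.1, h0.2]
      linear_combination -hI / 2
    · rw [(hleft j hj).1, (hleft j hj).2]
      simp
  have e4 : ∀ j < N, j ≠ 0 → ∑ i ∈ Finset.range (N + 2), newCoord N i * u (i, j) = 0 := by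
    intro j _ hj
    rw [sum_newCoord N fun i => u (i, j), (hleft j hj).1, (hleft j hj).2]
    simp
  have hcL : coeffLeft N u = -1 := by
    rw [coeffLeft, h0.1, h0.2]
    linear_combination hI / 2
  have hcR : coeffRight N u = 0 := by
    rw [coeffRight, hright 0 N le_rfl, hright 0 (N + 1) (by omega)]
    simp
  have hred : ∀ p ∈ sqIndex N, reduce N a b u p = 0 := by
    rintro ⟨i, j⟩ hp
    rw [mem_sqIndex] at hp
    dsimp only at hp
    rw [reduce, hcL, hcR, hval, if_neg (show ¬(i = N ∧ j = 0) by omega),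
      if_neg (show ¬(i = N + 1 ∧ j = 0) by omega)]
    simp only [Prod.mk.injEq]
    split_ifs <;> simp
  have hq0 : sesq N T (reduce N a b u) (reduce N a b u) = 0 := by
    unfold sesq
    exact Finset.sum_eq_zero fun p hp => Finset.sum_eq_zero fun r _ => by
      rw [hred p hp, zero_mul, zero_mul]
  have hmix : sesq (N + 2) (mixedTable N) u u = 0 := by
    rw [sesq_mixedTable hu, Finset.sum_eq_zero, Finset.sum_eq_zero, Finset.sum_eq_zero,
      Finset.sum_eq_zero]
    · simp
    · intro j hj
      rw [e4 j (Finset.mem_range.1 (Finset.mem_of_mem_erase hj)) (Finset.ne_of_mem_erase hj)]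
      simp
    · intro j hj
      rw [e3 j (Finset.mem_range.1 hj)]
      simp
    · intro j hj
      rw [e2 j (Finset.mem_range.1 (Finset.mem_of_mem_erase hj))]
      simp
    · intro j hj
      rw [e1 j (Finset.mem_range.1 hj)]
      simp
  have hnew : sesq (N + 2) (newTable N) u u = 0 := by
    rw [sesq_newTable, Finset.sum_eq_zero, Finset.sum_eq_zero]
    · simp
    · rintro ⟨i, j⟩ hp
      simp only [Finset.mem_product, Finset.mem_insert, Finset.mem_singleton] at hp
      rw [hright i j (by omega)]
      simp
    · rintro ⟨i, j⟩ _
      rcases lt_or_ge j N with hj | hj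
      · rw [diag_eq_zero (.inr (by simp; omega)), mul_zero]
      · rw [hright i j hj, zero_mul]
  unfold stepTable
  rw [sesq_add_table, sesq_add_table, sesq_mul_table, sesq_mul_table, hmix, hnew,
    sesq_productTable hT ha hb hu e1 e3, hq0, hcL, hcR]
  simp

lemma re_sesq_smul (n : ℕ) (S : FormTable) (u : ℕ × ℕ → ℂ) (r : ℝ) :
    (sesq n S (fun p => (r : ℂ) * u p) (fun p => (r : ℂ) * u p)).re
      = r ^ 2 * (sesq n S u u).re := by
  rw [sesq_smul, Complex.conj_ofReal, ← Complex.ofReal_mul, Complex.re_ofReal_mul, sq]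

/-- One-step extension: `e a ⊗ e b` gets within distance `√η` of the subspace of the `w ⊗ 1`. -/
theorem IsStrict.exists_step (hN : 0 < N) (hT : IsStrict N T) (ha : a < N) (hb : b < N)
    (hη : 0 < η) :
    ∃ T' : FormTable, IsStrict (N + 2) T' ∧
      (∀ i j k l, i < N → j < N → k < N → l < N → T' i j k l = T i j k l) ∧
      sesq (N + 2) T' (defect N a b) (defect N a b) = η := by
  have hclosed : IsClosed {u : ℕ × ℕ → ℂ | ∀ p ∉ sqIndex (N + 2), u p = 0} := by
    simp only [Set.ofPred_forall]
    exact isClosed_iInter fun p => isClosed_iInter fun _ =>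
      isClosed_eq (continuous_apply p) continuous_const
  have hclosed' : IsClosed {u : ℕ × ℕ → ℂ | ∀ i j, N ≤ i → N ≤ j → u (i, j) = 0} := by
    simp only [Set.ofPred_forall]
    exact isClosed_iInter fun i => isClosed_iInter fun j => isClosed_iInter fun _ =>
      isClosed_iInter fun _ => isClosed_eq (continuous_apply (i, j)) continuous_const
  -- `M` is chosen only for tensors without products of two new vectors, since elsewhere the mixed
  -- form need not be nonnegative.
  obtain ⟨M, -, hMpos⟩ := exists_pos_add_mul (sqIndex (N + 2))
    ({u | ∀ p ∉ sqIndex (N + 2), u p = 0} ∩ {u | ∀ i j, N ≤ i → N ≤ j → u (i, j) = 0})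
    (hclosed.inter hclosed') (fun u hu => hu.1)
    (fun u hu r => ⟨fun p hp => by simp [hu.1 p hp], fun i j hi hj => by simp [hu.2 i j hi hj]⟩)
    (fun u => (sesq (N + 2) (productTable N T a b η) u u).re)
    (fun u => (sesq (N + 2) (mixedTable N) u u).re)
    (continuous_sesq _ _) (continuous_sesq _ _) (re_sesq_smul _ _) (re_sesq_smul _ _)
    (fun u hu => by rw [sesq_mixedTable hu.2, Complex.ofReal_re]; positivity)
    (fun u hu hne hmix => sesq_productTable_pos hN hT ha hb hη hu.1 hu.2 hmix hne)
  -- The zeros of the new form are exactly the tensors covered by the choice of `M`.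
  obtain ⟨M', -, hMpos'⟩ := exists_pos_add_mul (sqIndex (N + 2))
    {u | ∀ p ∉ sqIndex (N + 2), u p = 0} hclosed (fun u hu => hu)
    (fun u hu r p hp => by simp [hu p hp])
    (fun u => (sesq (N + 2) (fun i j k l =>
      productTable N T a b η i j k l + M * mixedTable N i j k l) u u).re)
    (fun u => (sesq (N + 2) (newTable N) u u).re)
    (continuous_sesq _ _) (continuous_sesq _ _) (re_sesq_smul _ _) (re_sesq_smul _ _)
    (fun u hu => by rw [sesq_newTable, Complex.ofReal_re]; positivity)
    (fun u hu hne hnew => by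
      rw [sesq_add_table, sesq_mul_table, Complex.add_re, Complex.re_ofReal_mul]
      refine hMpos u ⟨hu, fun i j hi hj => ?_⟩ hne
      by_cases hp : (i, j) ∈ sqIndex (N + 2)
      swap
      · exact hu _ hp
      rw [mem_sqIndex] at hp
      dsimp only at hp
      rw [sesq_newTable, Complex.ofReal_re] at hnew
      have h0 := sq_nonneg ‖∑ p ∈ sqIndex (N + 2), u p * diag {N, N + 1} p.1 p.2‖
      have h1 : 0 ≤ ∑ p ∈ ({N, N + 1} : Finset ℕ) ×ˢ ({N, N + 1} : Finset ℕ), ‖u p‖ ^ 2 := by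
        positivity
      have h2 := (Finset.sum_eq_zero_iff_of_nonneg fun _ _ => by positivity).1
        (show ∑ p ∈ ({N, N + 1} : Finset ℕ) ×ˢ ({N, N + 1} : Finset ℕ), ‖u p‖ ^ 2 = 0 by linarith)
        (i, j) (by simp; omega)
      simpa using h2)
  refine ⟨stepTable N T a b η M M', ⟨stepTable_cyc hT M M', stepTable_herm hT M M',
    stepTable_of_ge hT M M', fun u ⟨p, hp, hpu⟩ => ?_⟩,
    fun i j k l hi hj hk hl => stepTable_of_lt M M' hi hj hk hl, sesq_defect hN hT ha hb M M'⟩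
  have hcongr : sesq (N + 2) (stepTable N T a b η M M') u u
      = sesq (N + 2) (stepTable N T a b η M M') (fun p => if p ∈ sqIndex (N + 2) then u p else 0)
        (fun p => if p ∈ sqIndex (N + 2) then u p else 0) :=
    sesq_congr (fun _ _ _ _ _ _ _ _ => rfl) (fun p hp => by simp [hp]) (fun p hp => by simp [hp])
  rw [hcongr]
  have := hMpos' (fun p => if p ∈ sqIndex (N + 2) then u p else 0) (fun p hp => by simp [hp])
    (fun h => hpu (by simpa [hp] using congrFun h p))
  unfold stepTable
  rw [sesq_add_table, sesq_mul_table (T := newTable N), Complex.add_re, Complex.re_ofReal_mul]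
  exact this

end


/-! ### Iteration and the limit table -/

/-- A cyclic hermitian table which is strictly positive on all finitely supported tensors. -/
structure IsPosDef (T : FormTable) : Prop where
  cyc : ∀ i j k l, T i j k l = T j k l i
  herm : ∀ i j k l, T i j k l = conj (T l k j i)
  pos : ∀ (N : ℕ) (u : ℕ × ℕ → ℂ), (∃ p ∈ sqIndex N, u p ≠ 0) → 0 < (sesq N T u u).re

/-- A strictly positive table extends to a strictly positive table on all indices, for which every
`e a ⊗ e b` is a limit of tensors `w ⊗ 1`. -/
theorem IsStrict.exists_limit {n : ℕ} (hn : 0 < n) {T₀ : FormTable} (hT₀ : IsStrict n T₀) :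
    ∃ T : FormTable, IsPosDef T ∧
      (∀ i j k l, i < n → j < n → k < n → l < n → T i j k l = T₀ i j k l) ∧
      ∀ (a b : ℕ) (δ : ℝ), 0 < δ → ∃ N, a < N ∧ b < N ∧
        (sesq (N + 2) T (defect N a b) (defect N a b)).re < δ := by
  -- Stage `k = pair m (pair a b)` treats `(a, b)` with `η = 1 / (k + 1)`. The indices `a, b ≤ k`
  -- already exist at this stage, and the free `m` makes every pair recur at arbitrarily late
  -- stages.
  have hstep : ∀ (k : ℕ) (T : {T : FormTable // IsStrict (n + 2 * k) T}),
      ∃ T' : {T : FormTable // IsStrict (n + 2 * (k + 1)) T},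
        (∀ i j x y, i < n + 2 * k → j < n + 2 * k → x < n + 2 * k → y < n + 2 * k →
          T'.1 i j x y = T.1 i j x y) ∧
        sesq (n + 2 * k + 2) T'.1
          (defect (n + 2 * k) (Nat.unpair (Nat.unpair k).2).1 (Nat.unpair (Nat.unpair k).2).2)
          (defect (n + 2 * k) (Nat.unpair (Nat.unpair k).2).1 (Nat.unpair (Nat.unpair k).2).2)
          = ((1 / ((k : ℝ) + 1) : ℝ) : ℂ) := by
    intro k T
    have h0 := Nat.unpair_right_le k
    have h1 := Nat.unpair_left_le (Nat.unpair k).2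
    have h2 := Nat.unpair_right_le (Nat.unpair k).2
    obtain ⟨T', h, h'⟩ := T.2.exists_step (a := (Nat.unpair (Nat.unpair k).2).1)
      (b := (Nat.unpair (Nat.unpair k).2).2) (η := 1 / ((k : ℝ) + 1)) (by omega) (by omega)
      (by omega) (by positivity)
    exact ⟨⟨T', h⟩, h'⟩
  choose next hnext_eq hnext_defect using hstep
  let S : (k : ℕ) → {T : FormTable // IsStrict (n + 2 * k) T} := fun k =>
    Nat.rec ⟨T₀, hT₀⟩ next k
  have hS : ∀ k, S (k + 1) = next k (S k) := fun k => rfl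
  have hmono : ∀ k m, k ≤ m → ∀ i j x y, i < n + 2 * k → j < n + 2 * k → x < n + 2 * k →
      y < n + 2 * k → (S m).1 i j x y = (S k).1 i j x y := by
    intro k m hkm i j x y hi hj hx hy
    induction m, hkm using Nat.le_induction with
    | base => rfl
    | succ m hm ih =>
      rw [hS, hnext_eq m (S m) i j x y (by omega) (by omega) (by omega) (by omega), ih]
  -- Any stage whose range contains the four indices would give the same value; the stage `i + j + x
  -- + y` is one, as `n > 0`.
  let T : FormTable := fun i j x y => (S (i + j + x + y)).1 i j x y
  have hTS : ∀ k i j x y, i < n + 2 * k → j < n + 2 * k → x < n + 2 * k → y < n + 2 * k →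
      T i j x y = (S k).1 i j x y := by
    intro k i j x y hi hj hx hy
    rw [← hmono k (max k (i + j + x + y)) (le_max_left _ _) i j x y hi hj hx hy]
    exact (hmono (i + j + x + y) _ (le_max_right _ _) i j x y (by omega) (by omega) (by omega)
      (by omega)).symm
  have hT' : ∀ i j x y, T i j x y = (S (i + j + x + y)).1 i j x y := fun _ _ _ _ => rfl
  refine ⟨T, ⟨fun i j x y => ?_, fun i j x y => ?_, fun N u ⟨p, hp, hpu⟩ => ?_⟩,
    fun i j x y hi hj hx hy => hTS 0 i j x y (by simpa) (by simpa) (by simpa) (by simpa),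
    fun a b δ hδ => ?_⟩
  · rw [hT', (S _).2.cyc, hTS (i + j + x + y) j x y i] <;> omega
  · rw [hT', (S _).2.herm, hTS (i + j + x + y) y x j i] <;> omega
  · have h1 : sesq N T u u = sesq N T (fun p => if p ∈ sqIndex N then u p else 0)
        (fun p => if p ∈ sqIndex N then u p else 0) :=
      sesq_congr (fun _ _ _ _ _ _ _ _ => rfl) (fun p hp => by simp [hp])
        (fun p hp => by simp [hp])
    have h2 : sesq (n + 2 * N) T (fun p => if p ∈ sqIndex N then u p else 0)
        (fun p => if p ∈ sqIndex N then u p else 0)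
        = sesq N T (fun p => if p ∈ sqIndex N then u p else 0)
        (fun p => if p ∈ sqIndex N then u p else 0) :=
      FormTable.sesq_of_le (by omega) (fun p r h => by simp [h]) (fun p r h => by simp [h])
    rw [h1, ← h2, sesq_congr (T := (S N).1) (hTS N) (fun _ _ => rfl) (fun _ _ => rfl)]
    exact (S N).2.pos _ ⟨p, sqIndex_mono (by omega) hp, by simpa [hp] using hpu⟩
  · obtain ⟨m, hm⟩ := exists_nat_one_div_lt hδ
    set k := Nat.pair m (Nat.pair a b) with hk
    have hk1 : m ≤ k := Nat.left_le_pair _ _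
    have hk2 : Nat.pair a b ≤ k := Nat.right_le_pair _ _
    have hka : a ≤ Nat.pair a b := Nat.left_le_pair _ _
    have hkb : b ≤ Nat.pair a b := Nat.right_le_pair _ _
    refine ⟨n + 2 * k, by omega, by omega, ?_⟩
    have h := hnext_defect k (S k)
    rw [← hS] at h
    simp only [hk, Nat.unpair_pair] at h
    rw [← hk] at h
    rw [sesq_congr (N := n + 2 * k + 2) (T := (S (k + 1)).1) (hTS (k + 1)) (fun _ _ => rfl) (fun _ _ => rfl), h,
      Complex.ofReal_re]
    refine lt_of_le_of_lt ?_ hm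
    gcongr

end FormTable

/-! ### Quadrilinear functions determined on a basis -/

section Multilinear

variable {V W : Type*} [AddCommGroup V] [Module ℝ V] [AddCommGroup W] [Module ℝ W]

lemma pureT_add_left (a a' b : V) : pureT (a + a') b = pureT a b + pureT a' b := by
  simp [pureT, TensorProduct.add_tmul, TensorProduct.tmul_add]

lemma pureT_add_right (a b b' : V) : pureT a (b + b') = pureT a b + pureT a b' := by
  simp [pureT, TensorProduct.tmul_add]

lemma pureT_smul_left (r : ℝ) (a b : V) : pureT (r • a) b = (r : ℂ) • pureT a b := by
  rw [pureT, pureT, TensorProduct.smul_tmul', ← TensorProduct.smul_tmul',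
    TensorProduct.tmul_smul, TensorProduct.smul_tmul']
  simp

lemma pureT_smul_right (r : ℝ) (a b : V) : pureT a (r • b) = (r : ℂ) • pureT a b := by
  rw [pureT, pureT, TensorProduct.smul_tmul', TensorProduct.tmul_smul, TensorProduct.tmul_smul,
    TensorProduct.smul_tmul']
  simp

/-- Real linearity of a complex function of four vectors in each of them. -/
structure IsQuadrilinear (Φ : V → V → V → V → ℂ) : Prop where
  fst : ∀ b c d, IsLinearMap ℝ fun a => Φ a b c d
  snd : ∀ a c d, IsLinearMap ℝ fun b => Φ a b c d
  thd : ∀ a b d, IsLinearMap ℝ fun c => Φ a b c d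
  fth : ∀ a b c, IsLinearMap ℝ fun d => Φ a b c d

lemma IsLinearMap.eq_of_basis {ι : Type*} (B : Module.Basis ι ℝ V) {f g : V → ℂ}
    (hf : IsLinearMap ℝ f) (hg : IsLinearMap ℝ g) (h : ∀ i, f (B i) = g (B i)) (v : V) :
    f v = g v := by
  have : hf.mk' f = hg.mk' g := B.ext h
  exact LinearMap.congr_fun this v

lemma IsQuadrilinear.eq_of_basis {ι : Type*} (B : Module.Basis ι ℝ V)
    {Φ Ψ : V → V → V → V → ℂ} (hΦ : IsQuadrilinear Φ) (hΨ : IsQuadrilinear Ψ)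
    (h : ∀ i j k l, Φ (B i) (B j) (B k) (B l) = Ψ (B i) (B j) (B k) (B l)) (a b c d : V) :
    Φ a b c d = Ψ a b c d := by
  refine IsLinearMap.eq_of_basis B (hΦ.fst b c d) (hΨ.fst b c d) (fun i => ?_) a
  refine IsLinearMap.eq_of_basis B (hΦ.snd _ c d) (hΨ.snd _ c d) (fun j => ?_) b
  refine IsLinearMap.eq_of_basis B (hΦ.thd _ _ d) (hΨ.thd _ _ d) (fun k => ?_) c
  exact IsLinearMap.eq_of_basis B (hΦ.fth _ _ _) (hΨ.fth _ _ _) (fun l => h i j k l) d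

lemma TensorForm.isQuadrilinear (S : TensorForm V) :
    IsQuadrilinear fun a b c d => S (pureT a b) (pureT c d) := by
  constructor <;> intros <;> constructor <;> intros <;>
    simp only [pureT_add_left, pureT_add_right, pureT_smul_left, pureT_smul_right, map_add,
      LinearMap.add_apply, map_smul, LinearMap.smul_apply, LinearMap.map_smulₛₗ,
      Complex.conj_ofReal, smul_eq_mul, Complex.real_smul]

lemma IsQuadrilinear.comp {Φ : W → W → W → W → ℂ} (hΦ : IsQuadrilinear Φ) (f : V →ₗ[ℝ] W) :
    IsQuadrilinear fun a b c d => Φ (f a) (f b) (f c) (f d) where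
  fst b c d := ((hΦ.fst (f b) (f c) (f d)).mk' _ ∘ₗ f).isLinear
  snd a c d := ((hΦ.snd (f a) (f c) (f d)).mk' _ ∘ₗ f).isLinear
  thd a b d := ((hΦ.thd (f a) (f b) (f d)).mk' _ ∘ₗ f).isLinear
  fth a b c := ((hΦ.fth (f a) (f b) (f c)).mk' _ ∘ₗ f).isLinear

lemma IsQuadrilinear.rotate {Φ : V → V → V → V → ℂ} (hΦ : IsQuadrilinear Φ) :
    IsQuadrilinear fun a b c d => Φ c a d b where
  fst b c d := hΦ.snd c d b
  snd a c d := hΦ.fth c a d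
  thd a b d := hΦ.fst a d b
  fth a b c := hΦ.thd c a b

end Multilinear

/-! ### From positive definite tables to cyclic spaces -/

namespace FormTable

section

variable {W : Type*} [AddCommGroup W] [Module ℝ W] (B : Module.Basis ℕ ℝ W) {T : FormTable}

/-- The basis of `(W ⊗ W) ⊗ ℂ` given by a basis of `W`. -/
def tensorBasis : Module.Basis (ℕ × ℕ) ℂ (CxTensor W) := (B.tensorProduct B).baseChange ℂ

lemma tensorBasis_apply (p : ℕ × ℕ) : tensorBasis B p = pureT (B p.1) (B p.2) := by
  simp [tensorBasis, pureT, Module.Basis.tensorProduct_apply']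

lemma tensorBasis_repr_pureT (a b : W) (p : ℕ × ℕ) :
    (tensorBasis B).repr (pureT a b) p = ((B.repr a p.1 * B.repr b p.2 : ℝ) : ℂ) := by
  obtain ⟨i, j⟩ := p
  simp [tensorBasis, pureT, mul_comm]

/-- The form with table `T` in the basis `B`. -/
def toForm (T : FormTable) : TensorForm W :=
  (tensorBasis B).constr ℂ fun p =>
    (starLinearEquiv ℂ (A := ℂ)).toLinearMap.comp
      ((tensorBasis B).constr ℂ fun r => conj (T p.1 p.2 r.2 r.1))

lemma toForm_basis (p r : ℕ × ℕ) :
    toForm B T (tensorBasis B p) (tensorBasis B r) = T p.1 p.2 r.2 r.1 := by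
  simp [toForm, Module.Basis.constr_basis]

lemma toForm_pureT (i j k l : ℕ) :
    toForm B T (pureT (B i) (B j)) (pureT (B k) (B l)) = T i j l k := by
  have := toForm_basis B (T := T) (i, j) (k, l)
  rwa [tensorBasis_apply, tensorBasis_apply] at this

lemma toForm_eq_sesq {N : ℕ} {u v : CxTensor W}
    (hu : ∀ p ∉ sqIndex N, (tensorBasis B).repr u p = 0)
    (hv : ∀ p ∉ sqIndex N, (tensorBasis B).repr v p = 0) :
    toForm B T u v = sesq N T ((tensorBasis B).repr u) ((tensorBasis B).repr v) := by
  have hexp : ∀ w : CxTensor W, (∀ p ∉ sqIndex N, (tensorBasis B).repr w p = 0) →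
      w = ∑ p ∈ sqIndex N, (tensorBasis B).repr w p • tensorBasis B p := by
    intro w hw
    conv_lhs => rw [← (tensorBasis B).linearCombination_repr w]
    rw [Finsupp.linearCombination_apply]
    refine Finsupp.sum_of_support_subset _ (fun p hp => ?_) _ (fun p _ => zero_smul _ _)
    by_contra h
    exact (Finsupp.mem_support_iff.1 hp) (hw p h)
  conv_lhs => rw [hexp u hu, hexp v hv]
  simp only [map_sum, LinearMap.sum_apply, map_smul, LinearMap.smul_apply, LinearMap.map_smulₛₗ,
    toForm_basis, smul_eq_mul, sesq, Finset.mul_sum]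
  rw [Finset.sum_comm]
  exact Finset.sum_congr rfl fun p _ => Finset.sum_congr rfl fun r _ => by ring

lemma exists_sqIndex (u : CxTensor W) :
    ∃ N, ∀ p ∉ sqIndex N, (tensorBasis B).repr u p = 0 := by
  refine ⟨((tensorBasis B).repr u).support.sup (fun p => p.1 + p.2) + 1, fun p hp => ?_⟩
  by_contra h
  have := Finset.le_sup (f := fun p : ℕ × ℕ => p.1 + p.2) (Finsupp.mem_support_iff.2 h)
  exact hp (mem_sqIndex.2 ⟨by omega, by omega⟩)

variable {B}

lemma IsPosDef.toForm_pos (hT : IsPosDef T) {u : CxTensor W} (hu : u ≠ 0) :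
    0 < (toForm B T u u).re := by
  obtain ⟨N, hN⟩ := exists_sqIndex B u
  rw [toForm_eq_sesq B hN hN]
  have hne : (tensorBasis B).repr u ≠ 0 := by simpa using hu
  obtain ⟨p, hp⟩ := Finsupp.ne_iff.1 hne
  refine hT.pos N _ ⟨p, ?_, hp⟩
  by_contra h
  exact hp (hN p h)

lemma IsPosDef.isScalarProduct (hT : IsPosDef T) : (toForm B T).IsScalarProduct where
  hermitian u v := by
    obtain ⟨N, hN⟩ := exists_sqIndex B u
    obtain ⟨N', hN'⟩ := exists_sqIndex B v
    have h1 : ∀ p ∉ sqIndex (max N N'), (tensorBasis B).repr u p = 0 :=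
      fun p hp => hN p fun h => hp (sqIndex_mono (le_max_left _ _) h)
    have h2 : ∀ p ∉ sqIndex (max N N'), (tensorBasis B).repr v p = 0 :=
      fun p hp => hN' p fun h => hp (sqIndex_mono (le_max_right _ _) h)
    rw [toForm_eq_sesq B h1 h2, toForm_eq_sesq B h2 h1, sesq_conj]
    simp only [← hT.herm]
  nonneg u := by
    rcases eq_or_ne u 0 with rfl | hu
    · simp
    · exact (hT.toForm_pos hu).le

lemma IsPosDef.toForm_cyclic (hT : IsPosDef T) (a b c d : W) :
    toForm B T (pureT a b) (pureT c d) = toForm B T (pureT c a) (pureT d b) := by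
  refine IsQuadrilinear.eq_of_basis B (toForm B T).isQuadrilinear
    (toForm B T).isQuadrilinear.rotate (fun i j k l => ?_) a b c d
  rw [toForm_pureT, toForm_pureT, hT.cyc k i j l]

/-- Self-adjointness is not a separate condition: hermitian symmetry followed by two rotations gives
it. -/
lemma IsPosDef.toForm_selfAdjoint (hT : IsPosDef T) (a b c d : W) :
    toForm B T (pureT a b) (pureT c d) = conj (toForm B T (pureT b a) (pureT d c)) := by
  rw [← hT.isScalarProduct.hermitian, hT.toForm_cyclic d c b a, hT.toForm_cyclic b d a c]

/-- The real inner product `Re ≪v ⊗ 1, w ⊗ 1≫`. -/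
@[reducible]
def IsPosDef.innerCore (hT : IsPosDef T) (B : Module.Basis ℕ ℝ W) :
    InnerProductSpace.Core ℝ W where
  inner v w := (toForm B T (pureT v (B 0)) (pureT w (B 0))).re
  conj_inner_symm v w := by
    rw [hT.isScalarProduct.hermitian]
    simp
  re_inner_nonneg v := hT.isScalarProduct.nonneg _
  add_left u v w := by simp [pureT_add_left]
  smul_left v w r := by simp [pureT_smul_left]
  definite v hv := by
    -- Strict positivity on tensors makes the inner product definite, because `v ⊗ B 0` determines
    -- `v`.
    have h0 : pureT v (B 0) = 0 := by
      by_contra h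
      exact (hT.toForm_pos (B := B) h).ne' hv
    rw [← B.repr.map_eq_zero_iff]
    ext i
    have := tensorBasis_repr_pureT B v (B 0) (i, 0)
    rw [h0] at this
    simpa using this.symm

end

/-- The space with basis indexed by `ℕ` and form given by a positive definite table. -/
def Model {T : FormTable} (_ : IsPosDef T) : Type := ℕ →₀ ℝ

namespace Model

variable {T : FormTable} (hT : IsPosDef T)

instance : NormedAddCommGroup (Model hT) :=
  (hT.innerCore (W := ℕ →₀ ℝ) Finsupp.basisSingleOne).toNormedAddCommGroup

instance : InnerProductSpace ℝ (Model hT) :=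
  InnerProductSpace.ofCore (hT.innerCore (W := ℕ →₀ ℝ) Finsupp.basisSingleOne).toCore

/-- The standard basis of the model. -/
def basis : Module.Basis ℕ ℝ (Model hT) :=
  (Finsupp.basisSingleOne : Module.Basis ℕ ℝ (ℕ →₀ ℝ))

lemma inner_eq (v w : Model hT) : inner ℝ v w
    = (toForm (basis hT) T (pureT v (basis hT 0)) (pureT w (basis hT 0))).re := rfl

/-- The cyclic structure of the model. -/
def cyclicStructure (h0 : T 0 0 0 0 = 1) : CyclicStructure (Model hT) where
  one := basis hT 0
  inner_one_one := by rw [inner_eq, toForm_pureT, h0, Complex.one_re]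
  form := toForm (basis hT) T
  isScalarProduct := hT.isScalarProduct
  left_isometric v := by
    rw [inner_eq]
    exact (Complex.conj_eq_iff_re.1 (hT.isScalarProduct.hermitian _ _).symm).symm
  right_isometric v := by
    rw [inner_eq, hT.toForm_cyclic, hT.toForm_cyclic]
    exact (Complex.conj_eq_iff_re.1 (hT.isScalarProduct.hermitian _ _).symm).symm
  cyclic := hT.toForm_cyclic
  selfAdjoint := hT.toForm_selfAdjoint

end Model

end FormTable

/-! ### Smoothing the given form to a strictly positive one -/

section Initial

open FormTable

variable {V : Type*} [NormedAddCommGroup V] [InnerProductSpace ℝ V]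

/-- The fourth moments of a free semicircular system indexed by `V`, corrected so that `s ⊗ s` has
norm one. -/
def semicircularForm (s a b c d : V) : ℂ :=
  ((inner ℝ a b * inner ℝ c d + inner ℝ b d * inner ℝ a c
    - inner ℝ a s * inner ℝ b s * inner ℝ c s * inner ℝ d s : ℝ) : ℂ)

lemma isQuadrilinear_semicircularForm (s : V) : IsQuadrilinear (semicircularForm s) := by
  constructor <;> intros <;> constructor <;> intros <;>
    simp only [semicircularForm, inner_add_left, inner_add_right, real_inner_smul_left,
      real_inner_smul_right, Complex.real_smul] <;> push_cast <;> ring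

namespace CyclicStructure

/-- The convex combination of the form of `C` and of `semicircularForm`. -/
def smoothed (C : CyclicStructure V) (δ : ℝ) (a b c d : V) : ℂ :=
  (1 - δ : ℝ) * C.form (pureT a b) (pureT c d) + δ * semicircularForm C.one a b c d

lemma isQuadrilinear_smoothed (C : CyclicStructure V) (δ : ℝ) :
    IsQuadrilinear (C.smoothed δ) := by
  have h1 := C.form.isQuadrilinear
  have h2 := isQuadrilinear_semicircularForm C.one
  constructor
  · intro b c d
    exact (((1 - δ : ℝ) : ℂ) • (h1.fst b c d).mk' _ + (δ : ℂ) • (h2.fst b c d).mk' _).isLinear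
  · intro b c d
    exact (((1 - δ : ℝ) : ℂ) • (h1.snd b c d).mk' _ + (δ : ℂ) • (h2.snd b c d).mk' _).isLinear
  · intro b c d
    exact (((1 - δ : ℝ) : ℂ) • (h1.thd b c d).mk' _ + (δ : ℂ) • (h2.thd b c d).mk' _).isLinear
  · intro b c d
    exact (((1 - δ : ℝ) : ℂ) • (h1.fth b c d).mk' _ + (δ : ℂ) • (h2.fth b c d).mk' _).isLinear

/-- At `v ⊗ 1` the correction cancels the extra pairing `⟨v, 1⟩²` of the semicircular moment. The
norm is therefore preserved exactly, and `V` will embed isometrically although its form is deformed.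
-/
lemma smoothed_one (C : CyclicStructure V) (δ : ℝ) (v : V) :
    C.smoothed δ v C.one v C.one = ((inner ℝ v v : ℝ) : ℂ) := by
  rw [smoothed, C.left_isometric, semicircularForm, C.inner_one_one]
  push_cast
  ring

lemma smoothed_cyclic (C : CyclicStructure V) (δ : ℝ) (a b c d : V) :
    C.smoothed δ a b c d = C.smoothed δ c a d b := by
  rw [smoothed, smoothed, C.cyclic, semicircularForm, semicircularForm, real_inner_comm a c,
    real_inner_comm d b]
  push_cast
  ring

lemma smoothed_hermitian (C : CyclicStructure V) (δ : ℝ) (a b c d : V) :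
    C.smoothed δ a b c d = conj (C.smoothed δ c d a b) := by
  rw [smoothed, smoothed, C.isScalarProduct.hermitian, map_add, map_mul, map_mul,
    Complex.conj_ofReal, Complex.conj_ofReal, semicircularForm, semicircularForm,
    Complex.conj_ofReal, real_inner_comm b d, real_inner_comm c a]
  push_cast
  ring

end CyclicStructure

variable {n : ℕ}

/-- The orthonormal basis `x`, extended by zero. -/
def extendVec (x : OrthonormalBasis (Fin n) ℝ V) (i : ℕ) : V :=
  if h : i < n then x ⟨i, h⟩ else 0

lemma inner_extendVec (x : OrthonormalBasis (Fin n) ℝ V) (i j : ℕ) :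
    ((inner ℝ (extendVec x i) (extendVec x j) : ℝ) : ℂ) = diag (Finset.range n) i j := by
  unfold extendVec diag
  by_cases hi : i < n <;> by_cases hj : j < n
  · rcases eq_or_ne i j with rfl | h
    · simp [hi]
    · simp [hi, hj, x.inner_eq_ite, h]
  · simp [hj]
  · rw [if_neg (by simp; omega)]
    simp [hi]
  · simp [hj]

/-- The table of `C.smoothed δ` in an orthonormal basis. -/
def initTable (C : CyclicStructure V) (x : OrthonormalBasis (Fin n) ℝ V) (δ : ℝ) : FormTable :=
  fun i j k l => C.smoothed δ (extendVec x i) (extendVec x j) (extendVec x l) (extendVec x k)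

lemma sesq_semicircularForm (hn : 0 < n) (x : OrthonormalBasis (Fin n) ℝ V) (u : ℕ × ℕ → ℂ) :
    sesq n (fun i j k l => semicircularForm (extendVec x 0) (extendVec x i) (extendVec x j)
        (extendVec x l) (extendVec x k)) u u
      = ((‖∑ p ∈ sqIndex n, u p * diag (Finset.range n) p.1 p.2‖ ^ 2
        + ∑ p ∈ sqIndex n, ‖u p‖ ^ 2 - ‖u (0, 0)‖ ^ 2 : ℝ) : ℂ) := by
  have hunit : ∀ i, diag (Finset.range n) i 0 = unitCoord i := by
    intro i
    simp [diag, unitCoord, hn]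
  have h1 : (fun i j k l => semicircularForm (extendVec x 0) (extendVec x i) (extendVec x j)
        (extendVec x l) (extendVec x k))
      = fun i j k l => diag (Finset.range n) i j * diag (Finset.range n) k l
        + diag (Finset.range n) j k * diag (Finset.range n) l i
        + (-1) * (unitCoord i * unitCoord j * (unitCoord k * unitCoord l)) := by
    funext i j k l
    rw [semicircularForm]
    push_cast
    simp only [inner_extendVec, hunit]
    rw [diag_comm _ l k, diag_comm _ i l]
    ring
  have h2 : ∀ f : ℕ × ℕ → ℂ,
      ∑ p ∈ sqIndex n, f p * (unitCoord p.1 * unitCoord p.2) = f (0, 0) := by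
    intro f
    rw [Finset.sum_eq_single_of_mem (0, 0) (mem_sqIndex.2 ⟨hn, hn⟩)]
    · simp [unitCoord]
    · rintro ⟨i, j⟩ _ hp
      have : i ≠ 0 ∨ j ≠ 0 := by
        by_contra! h
        exact hp (by rw [h.1, h.2])
      rcases this with h | h <;> simp [unitCoord_eq_zero h]
  have h3 := h2 fun p => conj (u p)
  rw [h1, sesq_add_table, sesq_mul_table, sesq_add_table, sesq_diag_diag,
    sesq_diag_mul_diag _ _ subset_rfl,
    sesq_split n (fun i j => unitCoord i * unitCoord j) (fun k l => unitCoord k * unitCoord l), h2]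
  simp only [mul_comm (unitCoord _) (unitCoord _)] at h3 ⊢
  rw [h3, Complex.mul_conj, Complex.normSq_eq_norm_sq, sqIndex]
  push_cast
  ring

/-- The subtracted square removes only the coordinate `(0, 0)` from the sum of squares. If all other
coordinates vanish, the trace term restores it. -/
lemma semicircular_pos (hn : 0 < n) {u : ℕ × ℕ → ℂ} (hu : ∃ p ∈ sqIndex n, u p ≠ 0) :
    0 < ‖∑ p ∈ sqIndex n, u p * diag (Finset.range n) p.1 p.2‖ ^ 2
        + ∑ p ∈ sqIndex n, ‖u p‖ ^ 2 - ‖u (0, 0)‖ ^ 2 := by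
  have h00 : ((0, 0) : ℕ × ℕ) ∈ sqIndex n := mem_sqIndex.2 ⟨hn, hn⟩
  rw [← Finset.add_sum_erase _ (fun p => ‖u p‖ ^ 2) h00]
  by_cases h : ∃ p ∈ (sqIndex n).erase (0, 0), u p ≠ 0
  · obtain ⟨p, hp, hpu⟩ := h
    have : 0 < ∑ p ∈ (sqIndex n).erase (0, 0), ‖u p‖ ^ 2 :=
      Finset.sum_pos' (fun _ _ => by positivity) ⟨p, hp, by positivity⟩
    have h2 := sq_nonneg ‖∑ p ∈ sqIndex n, u p * diag (Finset.range n) p.1 p.2‖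
    linarith
  · push Not at h
    have hu0 : u (0, 0) ≠ 0 := by
      obtain ⟨p, hp, hpu⟩ := hu
      rcases eq_or_ne p (0, 0) with rfl | hne
      · exact hpu
      · exact absurd (h p (Finset.mem_erase.2 ⟨hne, hp⟩)) hpu
    have h1 : ∑ p ∈ sqIndex n, u p * diag (Finset.range n) p.1 p.2 = u (0, 0) := by
      rw [Finset.sum_eq_single_of_mem (0, 0) h00 fun p hp hne => by
        rw [h p (Finset.mem_erase.2 ⟨hne, hp⟩), zero_mul]]
      simp [diag, hn]
    have h2 : 0 ≤ ∑ p ∈ (sqIndex n).erase (0, 0), ‖u p‖ ^ 2 := by positivity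
    have h3 : 0 < ‖u (0, 0)‖ ^ 2 := by positivity
    rw [h1]
    linarith

lemma sesq_form (S : TensorForm V) (y : ℕ → V) (u : ℕ × ℕ → ℂ) :
    sesq n (fun i j k l => S (pureT (y i) (y j)) (pureT (y l) (y k))) u u
      = S (∑ p ∈ sqIndex n, u p • pureT (y p.1) (y p.2))
          (∑ p ∈ sqIndex n, u p • pureT (y p.1) (y p.2)) := by
  simp only [map_sum, LinearMap.sum_apply, map_smul, LinearMap.smul_apply, LinearMap.map_smulₛₗ,
    smul_eq_mul, sesq, Finset.mul_sum]
  rw [Finset.sum_comm]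
  exact Finset.sum_congr rfl fun p _ => Finset.sum_congr rfl fun r _ => by ring

lemma isStrict_initTable (hn : 0 < n) (C : CyclicStructure V) (x : OrthonormalBasis (Fin n) ℝ V)
    (hx : extendVec x 0 = C.one) {δ : ℝ} (hδ : 0 < δ) (hδ1 : δ ≤ 1) :
    IsStrict n (initTable C x δ) where
  cyc i j k l := (C.smoothed_cyclic δ _ _ _ _).symm
  herm i j k l := C.smoothed_hermitian δ _ _ _ _
  supp i j k l hi := by
    have : extendVec x i = 0 := dif_neg (by omega)
    rw [initTable, this]
    exact ((C.isQuadrilinear_smoothed δ).fst _ _ _).map_zero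
  pos u hu := by
    unfold initTable CyclicStructure.smoothed
    rw [sesq_add_table, sesq_mul_table, sesq_mul_table, ← hx, sesq_semicircularForm hn x u,
      sesq_form, Complex.add_re, Complex.re_ofReal_mul, Complex.re_ofReal_mul, Complex.ofReal_re]
    have h1 := semicircular_pos hn hu
    have h2 := C.isScalarProduct.nonneg
      (∑ p ∈ sqIndex n, u p • pureT (extendVec x p.1) (extendVec x p.2))
    have h3 : 0 ≤ 1 - δ := by linarith
    positivity

end Initial

/-! ### Tensors at distance zero from `W ⊗ 1` -/

section Distance

open FormTable

variable {W : Type*} [NormedAddCommGroup W] [InnerProductSpace ℝ W]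

/-- Parallelogram law, with the square of `u - v` dropped. It replaces the triangle inequality, so
the closure argument can work with squared distances. -/
lemma TensorForm.IsScalarProduct.re_add_le {S : TensorForm W} (hS : S.IsScalarProduct)
    (u v : CxTensor W) : (S (u + v) (u + v)).re ≤ 2 * (S u u).re + 2 * (S v v).re := by
  have h := hS.nonneg (u - v)
  simp only [map_add, map_sub, LinearMap.add_apply, LinearMap.sub_apply, Complex.add_re,
    Complex.sub_re] at h ⊢
  linarith

/-- The tensors at distance zero from `W ⊗ 1` form a complex subspace. -/
def CyclicStructure.closureTensorOne (D : CyclicStructure W) : Submodule ℂ (CxTensor W) where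
  carrier := {u | ∀ δ > 0, ∃ z ∈ D.tensorOne, (D.form (u - z) (u - z)).re < δ}
  zero_mem' δ hδ := ⟨0, zero_mem _, by simpa using hδ⟩
  add_mem' {u v} hu hv δ hδ := by
    obtain ⟨y, hy, hy'⟩ := hu (δ / 4) (by positivity)
    obtain ⟨z, hz, hz'⟩ := hv (δ / 4) (by positivity)
    refine ⟨y + z, add_mem hy hz, ?_⟩
    rw [add_sub_add_comm]
    have := D.isScalarProduct.re_add_le (u - y) (v - z)
    linarith
  smul_mem' c u hu δ hδ := by
    obtain ⟨y, hy, hy'⟩ := hu (δ / (Complex.normSq c + 1)) (by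
      have := Complex.normSq_nonneg c
      positivity)
    refine ⟨c • y, Submodule.smul_mem _ c hy, ?_⟩
    have h1 : D.form (c • u - c • y) (c • u - c • y)
        = (Complex.normSq c : ℂ) * D.form (u - y) (u - y) := by
      rw [← smul_sub, LinearMap.map_smulₛₗ₂, LinearMap.map_smulₛₗ, RingHom.id_apply, smul_eq_mul,
        smul_eq_mul, ← mul_assoc, Complex.mul_conj]
    rw [h1, Complex.re_ofReal_mul]
    have h2 := Complex.normSq_nonneg c
    have h3 := D.isScalarProduct.nonneg (u - y)
    rw [lt_div_iff₀ (by positivity)] at hy'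
    nlinarith

lemma CyclicStructure.distTo_eq_zero (D : CyclicStructure W) {u : CxTensor W}
    (hu : u ∈ D.closureTensorOne) : D.distTo u (D.tensorOne : Set (CxTensor W)) = 0 := by
  refine le_antisymm (le_of_forall_pos_le_add fun δ hδ => ?_)
    (Real.sInf_nonneg (by rintro _ ⟨z, _, rfl⟩; exact Real.sqrt_nonneg _))
  obtain ⟨z, hz, hz'⟩ := hu (δ ^ 2) (by positivity)
  rw [zero_add]
  refine csInf_le_of_le ⟨0, by rintro _ ⟨z, _, rfl⟩; exact Real.sqrt_nonneg _⟩ ⟨z, hz, rfl⟩ ?_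
  exact Real.sqrt_le_iff.2 ⟨hδ.le, hz'.le⟩

/-- The closure being a subspace, basis tensors suffice; for `e a ⊗ e b` the approximant is `y ⊗ 1`,
and the difference has coordinates `defect N a b`. -/
lemma FormTable.Model.closureTensorOne_eq_top {T : FormTable} (hT : IsPosDef T)
    (h0 : T 0 0 0 0 = 1)
    (happrox : ∀ (a b : ℕ) (δ : ℝ), 0 < δ → ∃ N, a < N ∧ b < N ∧
        (sesq (N + 2) T (defect N a b) (defect N a b)).re < δ) :
    (Model.cyclicStructure hT h0).closureTensorOne = ⊤ := by
  set B := Model.basis hT with hB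
  rw [eq_top_iff, ← (tensorBasis B).span_eq, Submodule.span_le]
  rintro _ ⟨⟨a, b⟩, rfl⟩ δ hδ
  obtain ⟨N, ha, hb, hN⟩ := happrox a b δ hδ
  have hmem : ∀ i, tensorBasis B (i, 0) ∈ (Model.cyclicStructure hT h0).tensorOne := fun i => by
    rw [tensorBasis_apply]
    exact Submodule.subset_span ⟨B i, rfl⟩
  refine ⟨(1 / 2 : ℂ) • tensorBasis B (N, 0) - (Complex.I / 2) • tensorBasis B (N + 1, 0),
    sub_mem (Submodule.smul_mem _ _ (hmem N)) (Submodule.smul_mem _ _ (hmem (N + 1))), ?_⟩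
  set w := tensorBasis B (a, b)
    - ((1 / 2 : ℂ) • tensorBasis B (N, 0) - (Complex.I / 2) • tensorBasis B (N + 1, 0)) with hw
  have hrepr : ∀ p, (tensorBasis B).repr w p = defect N a b p := by
    intro p
    simp only [hw, map_sub, map_smul, Module.Basis.repr_self, Finsupp.sub_apply,
      Finsupp.smul_apply, Finsupp.single_apply, smul_eq_mul, defect, eq_comm (b := p)]
    split_ifs <;> ring
  have hsupp : ∀ p ∉ sqIndex (N + 2), (tensorBasis B).repr w p = 0 := by
    intro p hp
    have h1 : p ≠ (a, b) := by
      rintro rfl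
      exact hp (mem_sqIndex.2 ⟨by dsimp only; omega, by dsimp only; omega⟩)
    have h2 : p ≠ (N, 0) := by
      rintro rfl
      exact hp (mem_sqIndex.2 ⟨by dsimp only; omega, by dsimp only; omega⟩)
    have h3 : p ≠ (N + 1, 0) := by
      rintro rfl
      exact hp (mem_sqIndex.2 ⟨by dsimp only; omega, by dsimp only; omega⟩)
    rw [hrepr, defect, if_neg h1, if_neg h2, if_neg h3]
    simp
  change (toForm B T w w).re < δ
  rw [toForm_eq_sesq B hsupp hsupp, sesq_congr (fun _ _ _ _ _ _ _ _ => rfl)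
    (fun p _ => hrepr p) (fun p _ => hrepr p)]
  exact hN

end Distance

lemma TensorForm.IsScalarProduct.restrict {V W : Type*} [AddCommGroup V] [Module ℝ V]
    [AddCommGroup W] [Module ℝ W] {S : TensorForm W} (hS : S.IsScalarProduct) (f : V →ₗ[ℝ] W) :
    (S.restrict f).IsScalarProduct where
  hermitian _ _ := hS.hermitian _ _
  nonneg _ := hS.nonneg _

lemma TensorForm.restrict_pureT {V W : Type*} [AddCommGroup V] [Module ℝ V]
    [AddCommGroup W] [Module ℝ W] (S : TensorForm W) (f : V →ₗ[ℝ] W) (a b c d : V) :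
    S.restrict f (pureT a b) (pureT c d) = S (pureT (f a) (f b)) (pureT (f c) (f d)) := by
  simp [TensorForm.restrict, pureT]

lemma exists_smoothing {ι : Type*} [Finite ι] (F G : ι → ℂ) {ε : ℝ} (hε : 0 < ε) :
    ∃ δ : ℝ, 0 < δ ∧ δ ≤ 1 ∧ ∀ i, ‖F i - ((1 - δ : ℝ) * F i + δ * G i)‖ < ε := by
  cases nonempty_fintype ι
  set K : ℝ := ∑ i, ‖F i - G i‖ with hK
  have hK0 : 0 ≤ K := by positivity
  -- The error is `δ ‖F i - G i‖ ≤ δ K`; the `+ 1` makes the bound strict and covers `K = 0`.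
  refine ⟨min 1 (ε / (K + 1)), by positivity, min_le_left _ _, fun i => ?_⟩
  set δ := min 1 (ε / (K + 1)) with hδ
  have hδ0 : 0 < δ := by positivity
  have h1 : F i - ((1 - δ : ℝ) * F i + δ * G i) = (δ : ℂ) * (F i - G i) := by
    push_cast
    ring
  rw [h1, norm_mul, Complex.norm_real, Real.norm_of_nonneg hδ0.le]
  have h2 : ‖F i - G i‖ ≤ K :=
    Finset.single_le_sum (f := fun i => ‖F i - G i‖) (fun _ _ => norm_nonneg _) (Finset.mem_univ i)
  have h3 : δ * (K + 1) ≤ ε := by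
    rw [← le_div_iff₀ (by positivity)]
    exact min_le_right _ _
  nlinarith

end

/-! ### The main theorem -/

open FormTable

theorem mainTheorem2 {V : Type*} [NormedAddCommGroup V] [InnerProductSpace ℝ V]
    (C : CyclicStructure V) {n : ℕ} (x : OrthonormalBasis (Fin n) ℝ V)
    {ε : ℝ} (hε : 0 < ε) :
    ∃ (W : Type) (_ : NormedAddCommGroup W) (_ : InnerProductSpace ℝ W)
      (D : CyclicStructure W) (f : V →ₗᵢ[ℝ] W) (b : Module.Basis ℕ ℝ W),
      f C.one = D.one ∧
      (∀ i : Fin n, b (i : ℕ) = f (x i)) ∧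
      C.form.IsPerturbation x ε (D.form.restrict f.toLinearMap) ∧
      ∀ i j : ℕ, D.distTo (pureT (b i) (b j)) (D.tensorOne : Set (CxTensor W)) = 0 := by
  have hn : 0 < n := by
    rcases Nat.eq_zero_or_pos n with rfl | h
    · have h1 : C.one = 0 := by
        rw [← x.sum_repr C.one]
        simp
      have h2 := C.inner_one_one
      simp [h1] at h2
    · exact h
  have hfin : Module.finrank ℝ V = Fintype.card (Fin n) := Module.finrank_eq_card_basis x.toBasis
  have : FiniteDimensional ℝ V := x.toBasis.finiteDimensional_of_finite
  have hnorm : ‖C.one‖ = 1 := by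
    rw [norm_eq_sqrt_real_inner, C.inner_one_one, Real.sqrt_one]
  -- The tables need the pointed vector as basis vector of index 0, which `x` need not provide. The
  -- construction uses `x'`, while `δ` below is chosen for `x`, in which the deformation is
  -- measured.
  obtain ⟨x', hx'⟩ := Orthonormal.exists_orthonormalBasis_extension_of_card_eq (𝕜 := ℝ) hfin
    (v := fun _ : Fin n => C.one) (s := {⟨0, hn⟩})
    ⟨fun _ => hnorm, fun i j hij => absurd (Subsingleton.elim i j) hij⟩
  have hx0 : extendVec x' 0 = C.one := by
    rw [extendVec, dif_pos hn]
    exact hx' _ rfl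
  obtain ⟨δ, hδ, hδ1, hclose⟩ := exists_smoothing (ι := Fin n × Fin n × Fin n × Fin n)
    (fun p => C.form (pureT (x p.1) (x p.2.1)) (pureT (x p.2.2.1) (x p.2.2.2)))
    (fun p => semicircularForm C.one (x p.1) (x p.2.1) (x p.2.2.1) (x p.2.2.2)) hε
  obtain ⟨T, hT, hTinit, happrox⟩ := (isStrict_initTable hn C x' hx0 hδ hδ1).exists_limit hn
  have h0 : T 0 0 0 0 = 1 := by
    rw [hTinit 0 0 0 0 hn hn hn hn, initTable, hx0, C.smoothed_one, C.inner_one_one,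
      Complex.ofReal_one]
  let B := Model.basis hT
  -- `V × (ℕ →₀ ℝ)` is an auxiliary copy of the model. Identified with it through `P x'`, it carries
  -- `P x` to a basis of the model that starts with the images of the `x i`.
  let P : OrthonormalBasis (Fin n) ℝ V → Module.Basis ℕ ℝ (V × (ℕ →₀ ℝ)) := fun y =>
    (y.toBasis.prod Finsupp.basisSingleOne).reindex (finSumNatEquiv n)
  have hP : ∀ (y : OrthonormalBasis (Fin n) ℝ V) (i : Fin n), P y (i : ℕ) = (y i, 0) := by
    intro y i
    simp [P, Module.Basis.reindex_apply]
  let E : (V × (ℕ →₀ ℝ)) ≃ₗ[ℝ] Model hT := (P x').equiv B (Equiv.refl ℕ)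
  let g : V →ₗ[ℝ] Model hT := E.toLinearMap ∘ₗ LinearMap.inl ℝ V (ℕ →₀ ℝ)
  have hg : ∀ i : Fin n, g (x' i) = B i := by
    intro i
    change E (x' i, 0) = B i
    rw [← hP x' i, Module.Basis.equiv_apply, Equiv.refl_apply]
  have hform : ∀ a b c d : V, toForm B T (pureT (g a) (g b)) (pureT (g c) (g d))
      = C.smoothed δ a b c d := by
    refine IsQuadrilinear.eq_of_basis x'.toBasis ((toForm B T).isQuadrilinear.comp g)
      (C.isQuadrilinear_smoothed δ) fun i j k l => ?_
    simp only [OrthonormalBasis.coe_toBasis, hg]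
    rw [toForm_pureT, hTinit i j l k i.2 j.2 l.2 k.2, initTable]
    simp [extendVec]
  have hgone : g C.one = B 0 := by
    rw [← hx0, extendVec, dif_pos hn, hg]
  let f : V →ₗᵢ[ℝ] Model hT :=
    { toLinearMap := g
      norm_map' := fun v => by
        rw [norm_eq_sqrt_real_inner, norm_eq_sqrt_real_inner, Model.inner_eq]
        change √(toForm B T (pureT (g v) (B 0)) (pureT (g v) (B 0))).re = _
        rw [← hgone, hform, C.smoothed_one, Complex.ofReal_re] }
  refine ⟨Model hT, inferInstance, inferInstance, Model.cyclicStructure hT h0, f, (P x).map E,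
    hgone, fun i => ?_, ⟨(Model.cyclicStructure hT h0).isScalarProduct.restrict _, ?_⟩,
    fun i j => ?_⟩
  · rw [Module.Basis.map_apply, hP]
    rfl
  · intro i j k l
    rw [TensorForm.restrict_pureT]
    have := hclose (i, j, k, l)
    rwa [show (Model.cyclicStructure hT h0).form (pureT (f.toLinearMap (x i)) (f.toLinearMap (x j)))
      (pureT (f.toLinearMap (x k)) (f.toLinearMap (x l)))
      = C.smoothed δ (x i) (x j) (x k) (x l) from hform _ _ _ _]
  -- Every tensor is at distance zero, so passing from the basis `B` to one extending `x` costs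
  -- nothing.
  · apply CyclicStructure.distTo_eq_zero
    rw [Model.closureTensorOne_eq_top hT h0 happrox]
    trivial
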